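/- Let $(\Omega,\mathcal F,\mathbb P)$ be a complete probability space, $\vartheta:\Omega\to\Omega$ a $\mathbb P$-preserving transformation, and $X$ a compact metric space with Borel $\sigma$-algebra $\mathcal B$. Let $\mathcal E\in\mathcal F\otimes\mathcal B$ be a subset of $\Omega\times X$ whose fibers $\mathcal E_\omega=\{x\in X:(\omega,x)\in\mathcal E\}$ are nonempty and compact for all $\omega\in\Omega$. Let $T$ be a continuous bundle random dynamical system on $\mathcal E$, that is, a family of maps $T_\omega:\mathcal E_\omega\to\mathcal E_{\vartheta\omega}$ $(\omega\in\Omega)$ such that $(\omega,x)\mapsto T_\omega x$ is measurable on $\mathcal E$ and $x\mapsto T_\omega x$ is continuous for $\mathbb P$-almost all $\omega$. Write $T^0_\omega=\mathrm{id}$, $T^n_\omega=T_{\vartheta^{n-1}\omega}\circ\cdots\circ T_{\vartheta\omega}\circ T_\omega$ for $n\ge 1$, and let $\Theta:\mathcal E\to\mathcal E$, $\Theta(\omega,x)=(\vartheta\omega,T_\omega x)$, be the skew product. A Borel set $E\subset X$ is called $T$-small if for $\mathbb P$-almost every $\omega$ its $\omega$-orbit capacity $$\mathrm{ocap}^\omega(E)=\lim_{n\to\infty}\frac1n\sup_{x\in\mathcal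 E_\omega}\sum_{i=0}^{n-1}1_E(T^i_\omega x)$$ exists and equals $0$. Let $\mathcal I_{\mathbb P}(\mathcal E)$ be the set of all probability measures $\mu$ on $\Omega\times X$ that have marginal $\mathbb P$ on $\Omega$, satisfy $\mu(\mathcal E)=1$, and are $\Theta$-invariant. Then for every closed set $E\subset X$, $$E\text{ is }T\text{-small}\iff \mu(\Omega\times E)=0\ \text{ for all }\mu\in\mathcal I_{\mathbb P}(\mathcal E).$$ -/

import Mathlib

open MeasureTheory Filter Topology

noncomputable section

/-- The fiber `S_ω = {x | (ω, x) ∈ S}` of a subset `S` of `Ω × X`. -/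
def bundleFiber {Ω X : Type*} (S : Set (Ω × X)) (ω : Ω) : Set X := {x | (ω, x) ∈ S}

/-- A continuous bundle random dynamical system over `(Ω, P, ϑ)` with state space `X`: a measurable
set `bundle ⊆ Ω × X` whose fibers are nonempty and compact, and maps `T_ω` from the fiber over `ω`
to the fiber over `ϑ ω`, jointly measurable in `(ω, x)` and continuous for almost all `ω`. -/
structure BundleRDS {Ω : Type*} [MeasurableSpace Ω] (P : Measure Ω) (ϑ : Ω → Ω)
    (X : Type*) [MetricSpace X] [MeasurableSpace X] where
  bundle : Set (Ω × X)
  measurableSet_bundle : MeasurableSet bundle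
  nonempty_fiber : ∀ ω, (bundleFiber bundle ω).Nonempty
  isCompact_fiber : ∀ ω, IsCompact (bundleFiber bundle ω)
  map : ∀ ω, bundleFiber bundle ω → bundleFiber bundle (ϑ ω)
  measurable_map : Measurable fun p : bundle => (map p.1.1 ⟨p.1.2, p.2⟩ : X)
  continuous_map : ∀ᵐ ω ∂P, Continuous (map ω)

namespace BundleRDS

variable {Ω : Type*} [MeasurableSpace Ω] {P : Measure Ω} {ϑ : Ω → Ω}
  {X : Type*} [MetricSpace X] [MeasurableSpace X]

/-- The iterates `T_ω^n = T_{ϑ^{n-1} ω} ∘ ⋯ ∘ T_{ϑ ω} ∘ T_ω`. -/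
def iter (T : BundleRDS P ϑ X) :
    ∀ (n : ℕ) (ω : Ω), bundleFiber T.bundle ω → bundleFiber T.bundle (ϑ^[n] ω)
  | 0, _ => fun x => x
  | n + 1, ω => fun x => T.iter n (ϑ ω) (T.map ω x)

/-- The skew product `Θ (ω, x) = (ϑ ω, T_ω x)` on the bundle. -/
def skewProduct (T : BundleRDS P ϑ X) (p : T.bundle) : T.bundle :=
  ⟨(ϑ p.1.1, (T.map p.1.1 ⟨p.1.2, p.2⟩ : X)), (T.map p.1.1 ⟨p.1.2, p.2⟩).2⟩

theorem skewProduct_iterate (T : BundleRDS P ϑ X) (n : ℕ) (p : T.bundle) :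
    ((T.skewProduct^[n] p : T.bundle) : Ω × X)
      = (ϑ^[n] p.1.1, (T.iter n p.1.1 ⟨p.1.2, p.2⟩ : X)) := by
  induction n generalizing p with
  | zero => rfl
  | succ n ih =>
    rw [Function.iterate_succ_apply, ih]
    rfl

/-- `b_n(ω) = sup_{x ∈ E_ω} ∑_{i < n} 1_E (T_ω^i x)`: the largest number of visits to `E` during
the first `n` steps of an orbit that starts in the fiber over `ω`. -/
def maxVisits (T : BundleRDS P ϑ X) (E : Set X) (n : ℕ) (ω : Ω) : ℝ :=
  ⨆ x : bundleFiber T.bundle ω,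
    ∑ i ∈ Finset.range n, E.indicator (fun _ => (1 : ℝ)) (T.iter i ω x : X)

/-- The limit `lim_n b_n(ω) / n` defining the `ω`-orbit capacity of `E` exists and equals `c`. -/
def HasOrbitCapacity (T : BundleRDS P ϑ X) (E : Set X) (ω : Ω) (c : ℝ) : Prop :=
  Tendsto (fun n : ℕ => (1 / (n : ℝ)) * T.maxVisits E n ω) atTop (𝓝 c)

/-- `E` is `T`-small if its `ω`-orbit capacity is `0` for almost every `ω`. -/
def IsSmall (T : BundleRDS P ϑ X) (E : Set X) : Prop :=
  ∀ᵐ ω ∂P, T.HasOrbitCapacity E ω 0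

/-- The probability measures on `Ω × X` with marginal `P` on `Ω` that give the bundle mass one and
whose restriction to the bundle is invariant under the skew product. -/
structure IsInvariantRandomMeasure (T : BundleRDS P ϑ X) (μ : Measure (Ω × X)) : Prop where
  isProbabilityMeasure : IsProbabilityMeasure μ
  marginal : μ.map Prod.fst = P
  bundle_eq_one : μ T.bundle = 1
  invariant : MeasurePreserving T.skewProduct
    (μ.comap (Subtype.val : T.bundle → Ω × X)) (μ.comap (Subtype.val : T.bundle → Ω × X))

end BundleRDS

end

open MeasureTheory Filter Topology Set ProbabilityTheory
open scoped ENNReal NNReal BoundedContinuousFunction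

/-! Smallness forces null mass because, for an invariant `μ`, the mass of `univ ×ˢ E` equals the
mean visit frequency over `n` steps for every `n ≥ 1`. That frequency is at most `b_n(ω) / n`, where
`b_n` is `maxVisits E n`, so dominated convergence gives zero (`measure_eq_zero_of_isSmall`).

For the converse, `b_n` is a subadditive cocycle with `0 ≤ b_n ≤ n`, measurable by the projection
theorem. The maximal ergodic inequality yields `b_n / n → 0` almost everywhere as soon as `∫ b_k /
k` takes arbitrarily small values (`ae_tendsto_zero_of_subadditive`); Kingman's theorem is not
needed. Otherwise `∫ b_k ≥ ε k` for some `ε > 0` and all `k > 0`. As `E` is closed, visit counts are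
upper semicontinuous on almost every fiber, so a measurable section realizes `b_k`
(`exists_measurable_section_visits_eq`). Averaging its graph measure along `k` steps gives a measure
that is invariant up to `1 / k` and charges `univ ×ˢ E` with at least `ε`.

Since `Ω` carries no topology, the limit is taken through disintegrations. The approximate
conditions define decreasing, midpoint-closed sets of Markov kernels. Near-minimizers of an `L²`
norm on these sets are Cauchy by the parallelogram law, so a subsequence of kernels converges weakly
for almost every `ω` (`exists_tendsto_kernel_of_antitone_midpoint`). Continuity on compact fibers
passes invariance to the limit, and closedness of `E` preserves the mass bound
(`exists_invariant_measure_of_frequent_visits`). -/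

/-! ### Analytic sets and measurable projection. -/

/-- A truncation argument: the points of Baire space below `m` in the first `k` coordinates are
eventually contained in any open neighbourhood of the points below `m`. -/
theorem exists_forall_lt_le_subset_of_isOpen {m : ℕ → ℕ} {V : Set (ℕ → ℕ)} (hV : IsOpen V)
    (h : {y : ℕ → ℕ | ∀ i, y i ≤ m i} ⊆ V) :
    ∃ k, {y : ℕ → ℕ | ∀ i < k, y i ≤ m i} ⊆ V := by
  by_contra! hcon
  have hex : ∀ k, ∃ y : ℕ → ℕ, (∀ i < k, y i ≤ m i) ∧ y ∉ V := by
    intro k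
    obtain ⟨y, hy, hyV⟩ := Set.not_subset.1 (hcon k)
    exact ⟨y, hy, hyV⟩
  choose y hy hyV using hex
  have hC : IsCompact {y : ℕ → ℕ | ∀ i, y i ≤ m i} := by
    have : {y : ℕ → ℕ | ∀ i, y i ≤ m i} = Set.pi univ fun i => Set.Iic (m i) := by
      ext y; simp [Pi.le_def]
    rw [this]
    exact isCompact_univ_pi fun i => (Set.finite_Iic (m i)).isCompact
  -- Truncating by `m` moves the points into the compact box; in each fixed coordinate the
  -- truncation is eventually inactive, so the original points have the same limit.
  obtain ⟨z, hz, φ, hφ, hlim⟩ := hC.tendsto_subseq (x := fun k i => min (y k i) (m i))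
    (fun k i => min_le_right _ _)
  have hlim' : Tendsto (fun k => y (φ k)) atTop (𝓝 z) := by
    rw [tendsto_pi_nhds] at hlim ⊢
    intro i
    refine (hlim i).congr' ?_
    filter_upwards [eventually_gt_atTop i] with k hk
    exact min_eq_left (hy _ i (hk.trans_le hφ.le_apply))
  exact hV.isClosed_compl.mem_of_tendsto hlim' (Eventually.of_forall fun k => hyV _) (h hz)

/-- Capacitability of continuous images of Baire space. -/
theorem exists_isCompact_image_of_lt {α : Type*} [TopologicalSpace α] [MeasurableSpace α]
    [BorelSpace α] (μ : Measure α) [μ.OuterRegular] {f : (ℕ → ℕ) → α} (hf : Continuous f)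
    {a : ENNReal} (ha : a < μ (range f)) :
    ∃ K ⊆ range f, IsCompact K ∧ a ≤ μ K := by
  classical
  have step : ∀ (S : Set (ℕ → ℕ)) (k : ℕ), a < μ (f '' S) →
      ∃ m, a < μ (f '' (S ∩ {y | y k ≤ m})) := by
    intro S k hS
    have hU : f '' S = ⋃ m, f '' (S ∩ {y | y k ≤ m}) := by
      rw [← image_iUnion, ← inter_iUnion]
      congr 1
      refine (inter_eq_left.2 fun y _ => ?_).symm
      exact mem_iUnion.2 ⟨y k, le_refl (y k)⟩
    have hmono : Monotone fun m => f '' (S ∩ {y | y k ≤ m}) := fun m n hmn =>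
      image_mono (inter_subset_inter_right _ fun y hy => le_trans hy hmn)
    -- Continuity from below holds for arbitrary increasing sets, so the images need not be known to
    -- be measurable.
    rw [hU, hmono.measure_iUnion] at hS
    exact lt_iSup_iff.1 hS
  choose! next hnext using step
  let S : ℕ → Set (ℕ → ℕ) := fun k =>
    Nat.rec univ (fun k S => S ∩ {y | y k ≤ next S k}) k
  have hS : ∀ k, a < μ (f '' S k) := by
    intro k
    induction k with
    | zero => simpa [S] using ha
    | succ k ih => exact hnext _ k ih
  let m : ℕ → ℕ := fun k => next (S k) k
  have hSm : ∀ k, S k = {y | ∀ i < k, y i ≤ m i} := by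
    intro k
    induction k with
    | zero => simp [S]
    | succ k ih =>
      have : S (k + 1) = S k ∩ {y | y k ≤ m k} := rfl
      rw [this, ih]
      ext y
      simp only [mem_inter_iff, mem_ofPred_eq, Nat.lt_succ_iff_lt_or_eq]
      constructor
      · rintro ⟨h1, h2⟩ i (hi | rfl)
        exacts [h1 i hi, h2]
      · exact fun h => ⟨fun i hi => h i (Or.inl hi), h k (Or.inr rfl)⟩
  have hC : IsCompact {y : ℕ → ℕ | ∀ i, y i ≤ m i} := by
    have : {y : ℕ → ℕ | ∀ i, y i ≤ m i} = Set.pi univ fun i => Set.Iic (m i) := by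
      ext y; simp [Pi.le_def]
    rw [this]
    exact isCompact_univ_pi fun i => (Set.finite_Iic (m i)).isCompact
  refine ⟨f '' {y | ∀ i, y i ≤ m i}, image_subset_range _ _, hC.image hf, ?_⟩
  -- By outer regularity it suffices to bound open `U` containing the compact image; such a `U`
  -- already contains `f '' S k` for some `k`, whose measure exceeds `a`.
  rw [Set.measure_eq_iInf_isOpen]
  refine le_iInf₂ fun U hU => le_iInf fun hUo => ?_
  obtain ⟨k, hk⟩ := exists_forall_lt_le_subset_of_isOpen (hUo.preimage hf) (image_subset_iff.1 hU)
  refine (hS k).le.trans (measure_mono ?_)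
  rw [image_subset_iff, hSm]
  exact hk

/-- Analytic sets are universally measurable. -/
theorem MeasureTheory.AnalyticSet.nullMeasurableSet {α : Type*} [TopologicalSpace α]
    [PolishSpace α] [MeasurableSpace α] [BorelSpace α] {s : Set α} (hs : AnalyticSet s)
    (μ : Measure α) [IsFiniteMeasure μ] : NullMeasurableSet s μ := by
  let := TopologicalSpace.upgradeIsCompletelyMetrizable α
  rcases (by rwa [AnalyticSet] at hs : s = ∅ ∨ _) with rfl | ⟨f, hf, rfl⟩
  · exact nullMeasurableSet_empty
  by_cases h0 : μ (range f) = 0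
  · exact NullMeasurableSet.of_null h0
  have hlt : ∀ n : ℕ, μ (range f) - ((n : ENNReal) + 1)⁻¹ < μ (range f) := fun n =>
    ENNReal.sub_lt_self (measure_ne_top _ _) h0 (by simp)
  choose K hKs hK hKμ using fun n => exists_isCompact_image_of_lt μ hf (hlt n)
  have hle : μ (range f) ≤ μ (⋃ n, K n) := by
    have hlim : Tendsto (fun n : ℕ => μ (range f) - ((n : ENNReal) + 1)⁻¹) atTop
        (𝓝 (μ (range f) - 0)) := by
      refine ENNReal.Tendsto.sub tendsto_const_nhds ?_ (Or.inl (measure_ne_top _ _))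
      have := (tendsto_add_atTop_iff_nat 1).2 ENNReal.tendsto_inv_nat_nhds_zero
      simpa using this
    rw [tsub_zero] at hlim
    exact le_of_tendsto' hlim fun n => (hKμ n).trans (measure_mono (subset_iUnion K n))
  have hsub : (⋃ n, K n) ⊆ range f := iUnion_subset hKs
  have hm : MeasurableSet (⋃ n, K n) := MeasurableSet.iUnion fun n => (hK n).measurableSet
  have hae : (⋃ n, K n : Set α) =ᵐ[μ] toMeasurable μ (range f) :=
    ae_eq_of_subset_of_measure_ge (hsub.trans (subset_toMeasurable μ _))
      (by rwa [measure_toMeasurable]) hm.nullMeasurableSet (measure_ne_top _ _)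
  have hae' : (range f : Set α) =ᵐ[μ] (⋃ n, K n : Set α) := by
    refine Filter.EventuallyLE.antisymm ?_ hsub.eventuallyLE
    exact ((subset_toMeasurable μ (range f)).eventuallyLE).trans hae.symm.le
  exact hm.nullMeasurableSet.congr hae'.symm

/-- A measurable subset of a product depends on countably many measurable sets of the first
factor. -/
theorem MeasurableSet.exists_eq_preimage_prodMap_natBool {Ω X : Type*} [MeasurableSpace Ω]
    [MeasurableSpace X] {D : Set (Ω × X)} (hD : MeasurableSet D) :
    ∃ π : Ω → ℕ → Bool, Measurable π ∧ ∃ D' : Set ((ℕ → Bool) × X), MeasurableSet D' ∧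
      D = (fun p : Ω × X => (π p.1, p.2)) ⁻¹' D' := by
  classical
  rw [← generateFrom_prod] at hD
  induction D, hD using MeasurableSpace.generateFrom_induction with
  | hC t ht _ =>
    obtain ⟨A, hA, B, hB, rfl⟩ := ht
    refine ⟨fun ω _ => decide (ω ∈ A), measurable_pi_lambda _ fun _ => ?_,
      {y | y 0 = true} ×ˢ B, ?_, ?_⟩
    · refine measurable_to_bool ?_
      have : (fun ω => decide (ω ∈ A)) ⁻¹' {true} = A := by ext; simp
      rwa [this]
    · refine MeasurableSet.prod ?_ hB
      exact (measurable_pi_apply (X := fun _ => Bool) 0) (measurableSet_singleton true)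
    · ext p; simp
  | empty => exact ⟨fun _ _ => true, measurable_const, ∅, MeasurableSet.empty, rfl⟩
  | compl t _ ih =>
    obtain ⟨π, hπ, D', hD', rfl⟩ := ih
    exact ⟨π, hπ, D'ᶜ, hD'.compl, rfl⟩
  | iUnion s _ ih =>
    choose π hπ D' hD' hs using ih
    -- The countably many codes are interleaved into one by the pairing bijection of `ℕ × ℕ` with
    -- `ℕ`.
    refine ⟨fun ω k => π k.unpair.1 ω k.unpair.2, ?_,
      ⋃ n, (fun p : (ℕ → Bool) × X => ((fun j => p.1 (Nat.pair n j) : ℕ → Bool), p.2)) ⁻¹' D' n,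
      ?_, ?_⟩
    · exact measurable_pi_lambda _ fun k => (measurable_pi_apply _).comp (hπ _)
    · refine MeasurableSet.iUnion fun n => ?_
      refine Measurable.prodMk ?_ measurable_snd (hD' n)
      exact measurable_pi_lambda _ fun j => (measurable_pi_apply _).comp measurable_fst
    · ext p
      simp only [mem_iUnion, mem_preimage, Nat.unpair_pair]
      exact exists_congr fun n => by rw [hs n]; rfl

/-- The measurable projection theorem. -/
theorem MeasurableSet.image_fst_of_isComplete {Ω X : Type*} [MeasurableSpace Ω]
    (P : Measure Ω) [IsFiniteMeasure P] [P.IsComplete] [MeasurableSpace X] [StandardBorelSpace X]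
    {D : Set (Ω × X)} (hD : MeasurableSet D) : MeasurableSet (Prod.fst '' D) := by
  let := upgradeStandardBorel X
  -- `Ω` need not be standard Borel, so the projection is computed over Cantor space and pulled back
  -- along `π`; completeness of `P` turns the resulting null measurability into measurability.
  obtain ⟨π, hπ, D', hD', rfl⟩ := hD.exists_eq_preimage_prodMap_natBool
  have : PolishSpace (ℕ → Bool) := by
    let := TopologicalSpace.metrizableSpaceMetric (ℕ → Bool)
    infer_instance
  have hana : AnalyticSet (Prod.fst '' D') := hD'.analyticSet_image measurable_fst
  have himg : (Prod.fst '' ((fun p : Ω × X => (π p.1, p.2)) ⁻¹' D')) = π ⁻¹' (Prod.fst '' D') := by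
    ext ω
    simp
  rw [himg]
  have h := (hana.nullMeasurableSet (P.map π)).preimage
    (hπ.measurePreserving P).quasiMeasurePreserving
  exact h.measurable_of_complete

/-! ### Measurable selection from compact fibers. -/

section Selection

variable {Ω X : Type*} [MeasurableSpace Ω] (P : Measure Ω) [IsFiniteMeasure P] [P.IsComplete]

-- The supremum exceeds `a` exactly when some fiber point does, so each strict superlevel set is a
-- projection.
include P in
theorem measurable_ciSup_fiber [MeasurableSpace X] [StandardBorelSpace X] {S : Set (Ω × X)}
    (hS : MeasurableSet S) (hne : ∀ ω, (bundleFiber S ω).Nonempty) {g : Ω × X → ℝ}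
    (hg : Measurable g) (hbdd : ∀ ω, BddAbove (range fun x : bundleFiber S ω => g (ω, x))) :
    Measurable fun ω => ⨆ x : bundleFiber S ω, g (ω, x) := by
  refine measurable_of_Ioi fun a => ?_
  have : (fun ω => ⨆ x : bundleFiber S ω, g (ω, x)) ⁻¹' Ioi a
      = Prod.fst '' (S ∩ g ⁻¹' Ioi a) := by
    ext ω
    have := (hne ω).to_subtype
    rw [mem_preimage, mem_Ioi, lt_ciSup_iff (hbdd ω)]
    constructor
    · rintro ⟨x, hx⟩
      exact ⟨(ω, x), ⟨x.2, hx⟩, rfl⟩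
    · rintro ⟨⟨ω', x⟩, ⟨h1, h2⟩, rfl⟩
      exact ⟨⟨x, h1⟩, h2⟩
  rw [this]
  exact (hS.inter (hg measurableSet_Ioi)).image_fst_of_isComplete P

/-- The points of `S` whose second coordinate maximizes `g` in their fiber. -/
def fiberArgmax (S : Set (Ω × X)) (g : Ω × X → ℝ) : Set (Ω × X) :=
  {p | p ∈ S ∧ g p = ⨆ x : bundleFiber S p.1, g (p.1, x)}

variable [MetricSpace X] [CompactSpace X] [MeasurableSpace X] [BorelSpace X]

include P in
theorem fiberArgmax_properties {S : Set (Ω × X)} (hS : MeasurableSet S)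
    (hne : ∀ ω, (bundleFiber S ω).Nonempty) (hc : ∀ ω, IsCompact (bundleFiber S ω))
    {g : X → ℝ} (hg : Continuous g) :
    MeasurableSet (fiberArgmax S fun p => g p.2) ∧
      (∀ ω, (bundleFiber (fiberArgmax S fun p => g p.2) ω).Nonempty) ∧
      ∀ ω, IsCompact (bundleFiber (fiberArgmax S fun p => g p.2) ω) := by
  have hbdd : ∀ ω, BddAbove (range fun x : bundleFiber S ω => g x) := fun ω => by
    have := (hc ω).bddAbove_image hg.continuousOn
    rwa [image_eq_range] at this
  refine ⟨?_, fun ω => ?_, fun ω => ?_⟩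
  · have hgm : Measurable fun p : Ω × X => g p.2 := hg.measurable.comp measurable_snd
    exact hS.inter (measurableSet_eq_fun hgm
      ((measurable_ciSup_fiber P hS hne hgm hbdd).comp measurable_fst))
  · obtain ⟨x, hx, hmax⟩ := (hc ω).exists_isMaxOn (hne ω) hg.continuousOn
    have := (hne ω).to_subtype
    exact ⟨x, hx, le_antisymm (le_ciSup (hbdd ω) ⟨x, hx⟩) (ciSup_le fun y => hmax y.2)⟩
  · have hcl : IsClosed {x | g x = ⨆ y : bundleFiber S ω, g y} := isClosed_eq hg continuous_const
    exact (hc ω).inter_right hcl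

include P in
/-- A measurable set with nonempty compact fibers admits a measurable section. -/
theorem exists_measurable_section [Nonempty X] {S : Set (Ω × X)} (hS : MeasurableSet S)
    (hne : ∀ ω, (bundleFiber S ω).Nonempty) (hc : ∀ ω, IsCompact (bundleFiber S ω)) :
    ∃ s : Ω → X, Measurable s ∧ ∀ ω, (ω, s ω) ∈ S := by
  let u := TopologicalSpace.denseSeq X
  let D : ℕ → Set (Ω × X) := fun k =>
    Nat.rec S (fun k D => fiberArgmax D fun p => dist p.2 (u k)) k
  have hsucc : ∀ k, D (k + 1) = fiberArgmax (D k) fun p => dist p.2 (u k) := fun _ => rfl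
  have hD : ∀ k, MeasurableSet (D k) ∧ (∀ ω, (bundleFiber (D k) ω).Nonempty) ∧
      ∀ ω, IsCompact (bundleFiber (D k) ω) := by
    intro k
    induction k with
    | zero => exact ⟨hS, hne, hc⟩
    | succ k ih =>
      exact fiberArgmax_properties P ih.1 ih.2.1 ih.2.2 (g := fun x => dist x (u k)) (by fun_prop)
  have hint : ∀ ω, (⋂ k, bundleFiber (D k) ω).Nonempty := fun ω =>
    IsCompact.nonempty_iInter_of_sequence_nonempty_isCompact_isClosed _
      (fun k x hx => hx.1) (fun k => (hD k).2.1 ω) (hc ω)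
      fun k => ((hD k).2.2 ω).isClosed
  choose s hs using hint
  have hsD : ∀ ω k, (ω, s ω) ∈ D k := fun ω k => mem_iInter.1 (hs ω) k
  -- Maximizing the distance to every point of a dense sequence in turn leaves one point per fiber,
  -- since a point is determined by its distances to a dense set.
  have huniq : ∀ ω x, (∀ k, (ω, x) ∈ D k) → x = s ω := by
    intro ω x hx
    have hdist : ∀ k, dist x (u k) = dist (s ω) (u k) := fun k =>
      (hx (k + 1)).2.trans (hsD ω (k + 1)).2.symm
    have hfun : (fun y => dist x y) = fun y => dist (s ω) y :=
      (TopologicalSpace.denseRange_denseSeq X).equalizer (by fun_prop) (by fun_prop)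
        (funext hdist)
    have := congrFun hfun (s ω)
    rwa [dist_self, dist_eq_zero] at this
  refine ⟨s, fun B hB => ?_, fun ω => hsD ω 0⟩
  -- Uniqueness makes the intersection of the `D k` the graph of `s`, so preimages under `s` are
  -- again projections.
  have : s ⁻¹' B = Prod.fst '' ((⋂ k, D k) ∩ Prod.snd ⁻¹' B) := by
    ext ω
    constructor
    · exact fun h => ⟨(ω, s ω), ⟨mem_iInter.2 (hsD ω), h⟩, rfl⟩
    · rintro ⟨⟨ω', x⟩, ⟨h1, h2⟩, rfl⟩
      rw [mem_preimage, ← huniq ω' x (mem_iInter.1 h1)]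
      exact h2
  rw [this]
  exact ((MeasurableSet.iInter fun k => (hD k).1).inter
    (measurable_snd hB)).image_fst_of_isComplete P

end Selection

/-! ### Maximal inequality and subadditive cocycles. -/

section Ergodic

variable {Ω : Type*} [MeasurableSpace Ω] {P : Measure Ω} {ϑ : Ω → Ω}

/-- The running maximum `max_{n ≤ N} ∑_{i < n} g ∘ ϑ^i`, defined by recursion on `N`. -/
def birkhoffMaximum (ϑ : Ω → Ω) (g : Ω → ℝ) : ℕ → Ω → ℝ
  | 0, _ => 0
  | N + 1, ω => max 0 (g ω + birkhoffMaximum ϑ g N (ϑ ω))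

omit [MeasurableSpace Ω] in
theorem birkhoffMaximum_nonneg (g : Ω → ℝ) (N : ℕ) (ω : Ω) : 0 ≤ birkhoffMaximum ϑ g N ω := by
  cases N with
  | zero => exact le_rfl
  | succ N => exact le_max_left _ _

omit [MeasurableSpace Ω] in
theorem birkhoffMaximum_le_succ (g : Ω → ℝ) (N : ℕ) (ω : Ω) :
    birkhoffMaximum ϑ g N ω ≤ birkhoffMaximum ϑ g (N + 1) ω := by
  induction N generalizing ω with
  | zero => exact birkhoffMaximum_nonneg g 1 ω
  | succ N ih => exact max_le_max le_rfl (add_le_add_right (ih (ϑ ω)) (g ω))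

omit [MeasurableSpace Ω] in
theorem birkhoffSum_le_birkhoffMaximum (g : Ω → ℝ) (N : ℕ) (ω : Ω) :
    birkhoffSum ϑ g N ω ≤ birkhoffMaximum ϑ g N ω := by
  induction N generalizing ω with
  | zero => simp [birkhoffMaximum]
  | succ N ih =>
    rw [birkhoffSum_succ']
    exact (add_le_add_right (ih (ϑ ω)) (g ω)).trans (le_max_right _ _)

theorem integrable_birkhoffMaximum (hϑ : MeasurePreserving ϑ P P) {g : Ω → ℝ}
    (hg : Integrable g P) (N : ℕ) : Integrable (birkhoffMaximum ϑ g N) P := by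
  induction N with
  | zero => exact integrable_zero _ _ _
  | succ N ih =>
    exact (integrable_zero _ _ _).sup (hg.add (hϑ.integrable_comp_of_integrable ih))

theorem measurable_birkhoffMaximum (hϑ : Measurable ϑ) {g : Ω → ℝ}
    (hg : Measurable g) (N : ℕ) : Measurable (birkhoffMaximum ϑ g N) := by
  induction N with
  | zero => exact measurable_const
  | succ N ih => exact measurable_const.max (hg.add (ih.comp hϑ))

/-- Garsia's argument: where the maximum `M` is positive, `M - M ∘ ϑ ≤ g`; elsewhere `M = 0 ≤ M ∘
ϑ`. The integral of `M - M ∘ ϑ` vanishes by invariance. -/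
theorem setIntegral_birkhoffMaximum_pos_nonneg (hϑ : MeasurePreserving ϑ P P) {g : Ω → ℝ}
    (hgm : Measurable g) (hg : Integrable g P) (N : ℕ) :
    0 ≤ ∫ ω in {ω | 0 < birkhoffMaximum ϑ g N ω}, g ω ∂P := by
  set A := {ω | 0 < birkhoffMaximum ϑ g N ω}
  have hA : MeasurableSet A :=
    measurableSet_lt measurable_const (measurable_birkhoffMaximum hϑ.measurable hgm N)
  have hM := integrable_birkhoffMaximum hϑ hg N
  have hM' : Integrable (fun ω => birkhoffMaximum ϑ g N (ϑ ω)) P :=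
    hϑ.integrable_comp_of_integrable hM
  have hle : ∀ ω, birkhoffMaximum ϑ g N ω - birkhoffMaximum ϑ g N (ϑ ω) ≤ A.indicator g ω := by
    intro ω
    by_cases hω : ω ∈ A
    · rw [indicator_of_mem hω]
      have hpos : 0 < birkhoffMaximum ϑ g N ω := hω
      cases N with
      | zero => exact absurd hpos (lt_irrefl _)
      | succ N =>
        have h1 : birkhoffMaximum ϑ g (N + 1) ω
            = max 0 (g ω + birkhoffMaximum ϑ g N (ϑ ω)) := rfl
        have h2 := birkhoffMaximum_le_succ (ϑ := ϑ) g N (ϑ ω)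
        rcases max_choice 0 (g ω + birkhoffMaximum ϑ g N (ϑ ω)) with h | h <;>
          rw [h] at h1 <;> linarith
    · rw [indicator_of_notMem hω]
      have h1 : birkhoffMaximum ϑ g N ω ≤ 0 := not_lt.1 hω
      have h2 := birkhoffMaximum_nonneg (ϑ := ϑ) g N (ϑ ω)
      linarith
  rw [← integral_indicator hA]
  calc (0 : ℝ) = ∫ ω, (birkhoffMaximum ϑ g N ω - birkhoffMaximum ϑ g N (ϑ ω)) ∂P := by
        have h := integral_map hϑ.aemeasurable
          (hϑ.map_eq.symm ▸ hM.aestronglyMeasurable : AEStronglyMeasurable _ (P.map ϑ))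
        rw [hϑ.map_eq] at h
        rw [integral_sub hM hM', ← h, sub_self]
    _ ≤ _ := integral_mono (hM.sub hM') (hg.indicator hA) hle

/-- The maximal ergodic inequality (weak type (1,1) bound). -/
theorem measure_exists_birkhoffSum_gt_le [IsFiniteMeasure P] (hϑ : MeasurePreserving ϑ P P)
    {f : Ω → ℝ} (hfm : Measurable f) (hf : Integrable f P) (hf0 : ∀ ω, 0 ≤ f ω) {c : ℝ}
    (hc : 0 < c) :
    P {ω | ∃ n : ℕ, c * n < birkhoffSum ϑ f n ω} ≤ ENNReal.ofReal ((∫ ω, f ω ∂P) / c) := by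
  set g : Ω → ℝ := fun ω => f ω - c with hgdef
  have hgm : Measurable g := hfm.sub_const c
  have hg : Integrable g P := hf.sub (integrable_const c)
  have hsum : ∀ n ω, birkhoffSum ϑ g n ω = birkhoffSum ϑ f n ω - c * n := by
    intro n ω
    simp only [birkhoffSum, hgdef, Finset.sum_sub_distrib, Finset.sum_const, Finset.card_range,
      nsmul_eq_mul]
    ring
  have hsub : {ω | ∃ n : ℕ, c * n < birkhoffSum ϑ f n ω}
      ⊆ ⋃ N, {ω | 0 < birkhoffMaximum ϑ g N ω} := by
    rintro ω ⟨n, hn⟩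
    refine mem_iUnion.2 ⟨n, ?_⟩
    have := birkhoffSum_le_birkhoffMaximum (ϑ := ϑ) g n ω
    rw [hsum] at this
    exact lt_of_lt_of_le (sub_pos.2 hn) this
  have hmono : Monotone fun N => {ω | 0 < birkhoffMaximum ϑ g N ω} :=
    monotone_nat_of_le_succ fun N ω hω => lt_of_lt_of_le hω (birkhoffMaximum_le_succ g N ω)
  refine (measure_mono hsub).trans ?_
  rw [hmono.measure_iUnion]
  refine iSup_le fun N => ?_
  have h0 := setIntegral_birkhoffMaximum_pos_nonneg hϑ hgm hg N
  rw [integral_sub hf.integrableOn (integrable_const c), setIntegral_const, smul_eq_mul] at h0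
  have h1 : ∫ ω in {ω | 0 < birkhoffMaximum ϑ g N ω}, f ω ∂P ≤ ∫ ω, f ω ∂P :=
    setIntegral_le_integral hf (Eventually.of_forall hf0)
  rw [← ofReal_measureReal]
  refine ENNReal.ofReal_le_ofReal ?_
  rw [le_div_iff₀ hc]
  linarith

omit [MeasurableSpace Ω] in
/-- Averaging a subadditive cocycle over the `k` offsets of a partition into blocks of
length `k`. -/
theorem sum_subadditive_offsets_le {b : ℕ → Ω → ℝ} (hle : ∀ n ω, b n ω ≤ n)
    (hsub : ∀ m n ω, b (m + n) ω ≤ b m ω + b n (ϑ^[m] ω)) (k m : ℕ) (ω : Ω) :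
    ∑ r ∈ Finset.range k, b (k + m - r) (ϑ^[r] ω) ≤ birkhoffSum ϑ (b k) m ω + (k : ℝ) * k := by
  induction m generalizing ω with
  | zero =>
    rw [birkhoffSum_zero, zero_add]
    calc ∑ r ∈ Finset.range k, b (k + 0 - r) (ϑ^[r] ω) ≤ ∑ r ∈ Finset.range k, (k : ℝ) :=
          Finset.sum_le_sum fun r _ => (hle _ _).trans (by exact_mod_cast Nat.sub_le _ _)
      _ = (k : ℝ) * k := by simp
  | succ m ih =>
    have h1 := ih (ϑ ω)
    rw [birkhoffSum_succ']
    have h2 : b (k + (m + 1)) ω ≤ b k ω + b (m + 1) (ϑ^[k] ω) := hsub k (m + 1) ω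
    -- Both sides are the sum over `r = 0, …, k`, split at the last term or at the first.
    have h3 : ∑ r ∈ Finset.range k, b (k + (m + 1) - r) (ϑ^[r] ω)
        + b (k + (m + 1) - k) (ϑ^[k] ω)
        = ∑ r ∈ Finset.range k, b (k + m - r) (ϑ^[r] (ϑ ω)) + b (k + (m + 1)) ω := by
      rw [← Finset.sum_range_succ (fun r => b (k + (m + 1) - r) (ϑ^[r] ω)), Finset.sum_range_succ']
      simp only [Function.iterate_succ_apply, Function.iterate_zero, id_eq, Nat.sub_zero]
      congr 1
      refine Finset.sum_congr rfl fun r _ => ?_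
      congr 1
      omega
    rw [Nat.add_sub_cancel_left] at h3
    linarith

-- Discarding the first `r < k` steps costs at most `k`; summing over all offsets adds a second `k *
-- k` to the block estimate.
omit [MeasurableSpace Ω] in
theorem mul_subadditive_le {b : ℕ → Ω → ℝ} (hle : ∀ n ω, b n ω ≤ n)
    (hsub : ∀ m n ω, b (m + n) ω ≤ b m ω + b n (ϑ^[m] ω)) (k m : ℕ) (ω : Ω) :
    (k : ℝ) * b (k + m) ω ≤ birkhoffSum ϑ (b k) m ω + 2 * ((k : ℝ) * k) := by
  have h1 := sum_subadditive_offsets_le hle hsub k m ω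
  have h2 : ∑ r ∈ Finset.range k, b (k + m) ω
      ≤ ∑ r ∈ Finset.range k, ((k : ℝ) + b (k + m - r) (ϑ^[r] ω)) := by
    refine Finset.sum_le_sum fun r hr => ?_
    have hr' := Finset.mem_range.1 hr
    have h3 := hsub r (k + m - r) ω
    rw [show r + (k + m - r) = k + m by omega] at h3
    have h4 := hle r ω
    have h5 : (r : ℝ) ≤ k := by exact_mod_cast hr'.le
    linarith
  rw [Finset.sum_add_distrib] at h2
  simp only [Finset.sum_const, Finset.card_range, nsmul_eq_mul] at h2
  linarith

/-- A nonnegative subadditive cocycle whose normalized integrals are not bounded away from zero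
has normalized limit zero almost everywhere. -/
theorem ae_tendsto_zero_of_subadditive [IsFiniteMeasure P] (hϑ : MeasurePreserving ϑ P P)
    {b : ℕ → Ω → ℝ} (hm : ∀ n, Measurable (b n)) (h0 : ∀ n ω, 0 ≤ b n ω)
    (hle : ∀ n ω, b n ω ≤ n)
    (hsub : ∀ m n ω, b (m + n) ω ≤ b m ω + b n (ϑ^[m] ω))
    (hinf : ∀ ε > 0, ∃ k : ℕ, 0 < k ∧ ∫ ω, b k ω ∂P < ε * k) :
    ∀ᵐ ω ∂P, Tendsto (fun n : ℕ => (1 / (n : ℝ)) * b n ω) atTop (𝓝 0) := by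
  have hint : ∀ n, Integrable (b n) P := fun n =>
    Integrable.of_bound (hm n).aestronglyMeasurable n
      (Eventually.of_forall fun ω => by rw [Real.norm_of_nonneg (h0 n ω)]; exact hle n ω)
  have key : ∀ c : ℝ, 0 < c → ∀ᵐ ω ∂P, ∀ᶠ n : ℕ in atTop, b n ω ≤ c * n := by
    intro c hc
    rw [ae_iff]
    refine le_antisymm (le_of_forall_pos_le_add fun δ hδ => ?_) zero_le
    rw [zero_add]
    -- The bad set will have measure at most `∫ b k / (k * (c / 2)) ≤ ε / (c / 2)`, which fixes `ε`.
    obtain ⟨ε, hε, hεδ⟩ : ∃ ε : ℝ, 0 < ε ∧ ENNReal.ofReal (ε / (c / 2)) ≤ δ := by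
      rcases eq_or_ne δ ⊤ with rfl | hδt
      · exact ⟨1, one_pos, le_top⟩
      · refine ⟨δ.toReal * (c / 2), mul_pos (ENNReal.toReal_pos hδ.ne' hδt) (by positivity), ?_⟩
        rw [mul_div_cancel_right₀ _ (by positivity), ENNReal.ofReal_toReal hδt]
    obtain ⟨k, hk, hkε⟩ := hinf ε hε
    have hk' : (0 : ℝ) < k := by exact_mod_cast hk
    refine le_trans (measure_mono ?_) ((measure_exists_birkhoffSum_gt_le hϑ (hm k) (hint k)
      (h0 k) (c := k * (c / 2)) (by positivity)).trans (le_trans (ENNReal.ofReal_le_ofReal ?_) hεδ))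
    · intro ω hω
      have hω' : ∃ᶠ n : ℕ in atTop, c * n < b n ω := by
        simpa [Filter.Frequently] using hω
      -- Beyond this threshold `c * m > 4 * k`, so the error `2 * k * k` is absorbed by half of `k *
      -- c * m`; hence the level `k * (c / 2)`.
      obtain ⟨N, hN⟩ := exists_nat_gt (4 * (k : ℝ) / c)
      obtain ⟨n, hn, hcn⟩ := (frequently_atTop.1 hω') (N + k)
      obtain ⟨m, rfl⟩ := Nat.exists_eq_add_of_le (le_trans (Nat.le_add_left k N) hn)
      refine ⟨m, ?_⟩
      have h1 := mul_subadditive_le hle hsub k m ω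
      have h2 : 4 * (k : ℝ) < c * m := by
        rw [div_lt_iff₀ hc] at hN
        have : (N : ℝ) ≤ m := by exact_mod_cast (by omega : N ≤ m)
        nlinarith
      have h3 : (k : ℝ) * (c * ((k + m : ℕ) : ℝ)) < k * b (k + m) ω :=
        mul_lt_mul_of_pos_left hcn hk'
      push_cast at h3
      have h4 : (k : ℝ) * (4 * k) < k * (c * m) := mul_lt_mul_of_pos_left h2 hk'
      have h5 : 0 ≤ (k : ℝ) * (c * k) := by positivity
      nlinarith
    · rw [div_le_div_iff₀ (by positivity) (by positivity)]
      nlinarith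
  have hall : ∀ᵐ ω ∂P, ∀ j : ℕ, ∀ᶠ n : ℕ in atTop, b n ω ≤ (1 / ((j : ℝ) + 1)) * n :=
    ae_all_iff.2 fun j => key _ (by positivity)
  filter_upwards [hall] with ω hω
  rw [Metric.tendsto_atTop']
  intro ε hε
  obtain ⟨j, hj⟩ := exists_nat_one_div_lt hε
  obtain ⟨N, hN⟩ := eventually_atTop.1 (hω j)
  refine ⟨N, fun n hn => ?_⟩
  have hn0 : (0 : ℝ) < n := by exact_mod_cast (Nat.zero_le N).trans_lt hn
  rw [Real.dist_0_eq_abs, abs_of_nonneg (mul_nonneg (by positivity) (h0 n ω)), one_div,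
    inv_mul_lt_iff₀ hn0]
  nlinarith [hN n hn.le]

end Ergodic

/-! ### Weak limits of kernels by minimal norms. -/

/-- Decreasing nonempty bounded sets of a Hilbert space that are closed under midpoints contain a
Cauchy sequence (of almost minimal norm). -/
theorem exists_cauchySeq_mem_of_antitone_midpoint {V : Type*} [NormedAddCommGroup V]
    [InnerProductSpace ℝ V] {C : ℕ → Set V} (hC : Antitone C) (hne : ∀ n, (C n).Nonempty)
    (hmid : ∀ n, ∀ u ∈ C n, ∀ v ∈ C n, (1 / 2 : ℝ) • (u + v) ∈ C n)
    {R : ℝ} (hR : ∀ u ∈ C 0, ‖u‖ ^ 2 ≤ R) :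
    ∃ v : ℕ → V, (∀ n, v n ∈ C n) ∧ CauchySeq v := by
  let q : V → ℝ := fun u => ‖u‖ ^ 2
  let d : ℕ → ℝ := fun n => sInf (q '' C n)
  have hbdd : ∀ n, BddBelow (q '' C n) := fun n =>
    ⟨0, by rintro _ ⟨u, _, rfl⟩; positivity⟩
  have hd_le : ∀ n, ∀ u ∈ C n, d n ≤ q u := fun n u hu => csInf_le (hbdd n) ⟨u, hu, rfl⟩
  have hd_mono : Monotone d := fun m n hmn =>
    csInf_le_csInf (hbdd m) ((hne n).image q) (image_mono (hC hmn))
  have hd_bdd : BddAbove (range d) := by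
    refine ⟨R, ?_⟩
    rintro _ ⟨n, rfl⟩
    obtain ⟨u, hu⟩ := hne n
    exact (hd_le n u hu).trans (hR u (hC (Nat.zero_le n) hu))
  obtain ⟨L, hL⟩ : ∃ L, Tendsto d atTop (𝓝 L) := ⟨_, tendsto_atTop_ciSup hd_mono hd_bdd⟩
  have hdL : ∀ n, d n ≤ L := fun n => hd_mono.ge_of_tendsto hL n
  have hex : ∀ n, ∃ u ∈ C n, q u < d n + 1 / ((n : ℝ) + 1) := by
    intro n
    obtain ⟨_, ⟨u, hu, rfl⟩, h⟩ := exists_lt_of_csInf_lt ((hne n).image q)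
      (show d n < d n + 1 / ((n : ℝ) + 1) from lt_add_of_pos_right _ (by positivity))
    exact ⟨u, hu, h⟩
  choose v hv hvq using hex
  refine ⟨v, hv, ?_⟩
  -- The midpoint of `v n` and `v m` lies in `C n`, so its squared norm is at least `d n`; the
  -- parallelogram law then bounds the distance.
  have hdist : ∀ n m, n ≤ m → dist (v n) (v m) ^ 2 ≤ 4 * (L - d n + 1 / ((n : ℝ) + 1)) := by
    intro n m hnm
    have h1 : d n ≤ q ((1 / 2 : ℝ) • (v n + v m)) :=
      hd_le n _ (hmid n _ (hv n) _ (hC hnm (hv m)))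
    have h2 : q ((1 / 2 : ℝ) • (v n + v m)) = 1 / 4 * ‖v n + v m‖ ^ 2 := by
      simp only [q, norm_smul]
      norm_num
      ring
    have h3 := parallelogram_law_with_norm ℝ (v n) (v m)
    have h4 : 1 / ((m : ℝ) + 1) ≤ 1 / ((n : ℝ) + 1) := by
      have : (n : ℝ) ≤ m := by exact_mod_cast hnm
      gcongr
    have h5 : ‖v n‖ ^ 2 < _ := hvq n
    have h6 : ‖v m‖ ^ 2 < _ := hvq m
    have h7 := hdL n
    have h8 := hdL m
    rw [dist_eq_norm]
    nlinarith
  have hlim : Tendsto (fun n : ℕ => √(4 * (L - d n + 1 / ((n : ℝ) + 1)))) atTop (𝓝 0) := by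
    have : Tendsto (fun n : ℕ => 4 * (L - d n + 1 / ((n : ℝ) + 1))) atTop
        (𝓝 (4 * (L - L + 0))) :=
      ((tendsto_const_nhds.sub hL).add tendsto_one_div_add_atTop_nhds_zero_nat).const_mul 4
    have h := this.sqrt
    simpa using h
  refine cauchySeq_of_le_tendsto_0' _ (fun n m hnm => ?_) hlim
  exact Real.le_sqrt_of_sq_le (hdist n m hnm)

section KernelLimit

variable {Ω X : Type*} [MeasurableSpace Ω]

/-- The kernel `ω ↦ (κ ω + η ω) / 2`. -/
noncomputable def ProbabilityTheory.Kernel.midpoint [MeasurableSpace X] (κ η : Kernel Ω X) : Kernel Ω X where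
  toFun ω := (2⁻¹ : NNReal) • (κ ω + η ω)
  measurable' := by
    refine Measure.measurable_of_measurable_coe _ fun s hs => ?_
    simp only [Measure.smul_apply, Measure.add_apply]
    exact ((κ.measurable_coe hs).add (η.measurable_coe hs)).const_smul _

theorem ProbabilityTheory.Kernel.midpoint_apply [MeasurableSpace X] (κ η : Kernel Ω X) (ω : Ω) :
    κ.midpoint η ω = (2⁻¹ : NNReal) • (κ ω + η ω) := rfl

instance [MeasurableSpace X] (κ η : Kernel Ω X) [IsMarkovKernel κ] [IsMarkovKernel η] :
    IsMarkovKernel (κ.midpoint η) := by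
  refine ⟨fun ω => ⟨?_⟩⟩
  rw [Kernel.midpoint_apply, Measure.smul_apply, Measure.add_apply, measure_univ, measure_univ,
    one_add_one_eq_two, ENNReal.smul_def, smul_eq_mul, ENNReal.coe_inv two_ne_zero]
  exact ENNReal.inv_mul_cancel (by simp) (by simp)

/-- The values of a Markov kernel as elements of the space of probability measures. -/
noncomputable def ProbabilityTheory.Kernel.toProbabilityMeasure [MeasurableSpace X]
    (κ : Kernel Ω X) [IsMarkovKernel κ] (ω : Ω) : ProbabilityMeasure X :=
  ⟨κ ω, inferInstance⟩

variable [MetricSpace X] [CompactSpace X] [MeasurableSpace X] [BorelSpace X]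

/-- A sequence in the compact space of probability measures converges if the integrals of a dense
sequence of functions converge. -/
theorem exists_tendsto_probabilityMeasure_of_dense {F : ℕ → C(X, ℝ)} (hF : DenseRange F)
    (μ : ℕ → ProbabilityMeasure X)
    (h : ∀ j, ∃ c, Tendsto (fun n => ∫ x, F j x ∂(μ n : Measure X)) atTop (𝓝 c)) :
    ∃ ν : ProbabilityMeasure X, Tendsto μ atTop (𝓝 ν) := by
  choose c hc using h
  have hint : ∀ (ν : ProbabilityMeasure X) (f : C(X, ℝ)), Integrable f (ν : Measure X) :=
    fun ν f => f.continuous.integrable_of_hasCompactSupport (HasCompactSupport.of_compactSpace f)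
  have hcont : ∀ f : C(X, ℝ), Continuous fun ν : ProbabilityMeasure X =>
      ∫ x, f x ∂(ν : Measure X) := by
    intro f
    refine continuous_iff_continuousAt.2 fun ν => ?_
    exact (ProbabilityMeasure.tendsto_iff_forall_integral_tendsto.1 tendsto_id)
      (BoundedContinuousFunction.mkOfCompact f)
  obtain ⟨ν, -, hν⟩ := isCompact_univ (X := ProbabilityMeasure X) (f := map μ atTop) (by simp)
  refine ⟨ν, tendsto_nhds_of_unique_mapClusterPt fun ν' hν' => ?_⟩
  have hval : ∀ ν₀ : ProbabilityMeasure X, MapClusterPt ν₀ atTop μ →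
      ∀ j, ∫ x, F j x ∂(ν₀ : Measure X) = c j := by
    intro ν₀ hν₀ j
    have : MapClusterPt (∫ x, F j x ∂(ν₀ : Measure X)) atTop
        fun n => ∫ x, F j x ∂(μ n : Measure X) :=
      hν₀.tendsto_comp (hcont (F j)).continuousAt
    have hne : (𝓝 (∫ x, F j x ∂(ν₀ : Measure X)) ⊓ 𝓝 (c j)).NeBot := this.clusterPt.mono (hc j)
    exact eq_of_nhds_neBot hne
  have heq : ∀ f : C(X, ℝ), ∫ x, f x ∂(ν' : Measure X) = ∫ x, f x ∂(ν : Measure X) := by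
    have hcf : ∀ ν₀ : ProbabilityMeasure X,
        Continuous fun f : C(X, ℝ) => ∫ x, f x ∂(ν₀ : Measure X) := by
      intro ν₀
      refine (LipschitzWith.of_dist_le_mul (K := 1) fun f g => ?_).continuous
      rw [Real.dist_eq, ← integral_sub (hint ν₀ f) (hint ν₀ g), dist_eq_norm, NNReal.coe_one,
        one_mul]
      refine (norm_integral_le_of_norm_le_const (Eventually.of_forall fun x =>
        (f - g).norm_coe_le_norm x)).trans_eq ?_
      simp
    exact congrFun (hF.equalizer (hcf ν') (hcf ν)
      (funext fun j => (hval ν' hν' j).trans (hval ν hν j).symm))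
  have : (ν' : Measure X) = (ν : Measure X) :=
    ext_of_forall_integral_eq_of_IsFiniteMeasure fun f => heq f.toContinuousMap
  exact Subtype.ext this

-- Integrals of bounded continuous functions are measurable as limits; closed sets follow by outer
-- approximation, and they form a generating π-system.
omit [CompactSpace X] in
theorem measurable_toMeasure_of_tendsto {μ : ℕ → Ω → ProbabilityMeasure X}
    {ν : Ω → ProbabilityMeasure X} (hμ : ∀ n, Measurable fun ω => (μ n ω : Measure X))
    (h : ∀ ω, Tendsto (fun n => μ n ω) atTop (𝓝 (ν ω))) :
    Measurable fun ω => (ν ω : Measure X) := by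
  have hf : ∀ f : BoundedContinuousFunction X NNReal,
      Measurable fun ω => ∫⁻ x, f x ∂(ν ω : Measure X) := fun f =>
    measurable_of_tendsto_metrizable
      (fun n => (Measure.measurable_lintegral
        (by fun_prop : Measurable fun x => (f x : ENNReal))).comp (hμ n))
      (tendsto_pi_nhds.2 fun ω =>
        ProbabilityMeasure.tendsto_iff_forall_lintegral_tendsto.1 (h ω) f)
  refine Measurable.measure_of_isPiSystem_of_isProbabilityMeasure
    (BorelSpace.measurable_eq.trans borel_eq_generateFrom_isClosed) isPiSystem_isClosed
    fun C hC => ?_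
  have hC' : IsClosed C := hC
  exact measurable_of_tendsto_metrizable (fun n => hf (hC'.apprSeq n))
    (tendsto_pi_nhds.2 fun ω => HasOuterApproxClosed.tendsto_lintegral_apprSeq hC' _)

/-- The averages `∫ F_j dκ_ω`, normalized so that they are bounded by one. -/
noncomputable def normalizedAverage (F : ℕ → C(X, ℝ)) (κ : Kernel Ω X) (p : Ω × ℕ) : ℝ :=
  (1 + ‖F p.2‖)⁻¹ * ∫ x, F p.2 x ∂κ p.1

theorem measurable_normalizedAverage (F : ℕ → C(X, ℝ)) (κ : Kernel Ω X) :
    Measurable (normalizedAverage F κ) :=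
  measurable_from_prod_countable_left fun j =>
    ((F j).continuous.stronglyMeasurable.integral_kernel (κ := κ)).measurable.const_mul
      (1 + ‖F j‖)⁻¹

omit [BorelSpace X] in
theorem norm_normalizedAverage_le (F : ℕ → C(X, ℝ)) (κ : Kernel Ω X) [IsMarkovKernel κ]
    (p : Ω × ℕ) : ‖normalizedAverage F κ p‖ ≤ 1 := by
  have h : ‖∫ x, F p.2 x ∂κ p.1‖ ≤ ‖F p.2‖ := by
    refine (norm_integral_le_of_norm_le_const (Eventually.of_forall fun x =>
      (F p.2).norm_coe_le_norm x)).trans_eq ?_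
    simp
  have h0 : 0 < 1 + ‖F p.2‖ := by positivity
  rw [normalizedAverage, norm_mul, norm_inv, Real.norm_of_nonneg h0.le, inv_mul_le_iff₀ h0]
  linarith

theorem normalizedAverage_midpoint (F : ℕ → C(X, ℝ)) (κ η : Kernel Ω X) [IsMarkovKernel κ]
    [IsMarkovKernel η] (p : Ω × ℕ) :
    normalizedAverage F (κ.midpoint η) p
      = (1 / 2 : ℝ) * (normalizedAverage F κ p + normalizedAverage F η p) := by
  have hint : ∀ (κ : Kernel Ω X) [IsMarkovKernel κ], Integrable (F p.2) (κ p.1) := fun κ _ =>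
    (F p.2).continuous.integrable_of_hasCompactSupport (HasCompactSupport.of_compactSpace _)
  simp only [normalizedAverage, Kernel.midpoint_apply]
  rw [integral_smul_nnreal_measure, integral_add_measure (hint κ) (hint η), NNReal.smul_def]
  simp
  ring

/-- Antitone sequences of nonempty midpoint-closed sets of Markov kernels into a compact metric
space contain a sequence of kernels that converges weakly almost everywhere. -/
theorem exists_tendsto_kernel_of_antitone_midpoint (P : Measure Ω) [IsProbabilityMeasure P]
    {K : ℕ → Set (Kernel Ω X)} (hanti : Antitone K) (hne : ∀ n, (K n).Nonempty)
    (hmark : ∀ n, ∀ κ ∈ K n, IsMarkovKernel κ)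
    (hmid : ∀ n, ∀ κ ∈ K n, ∀ η ∈ K n, κ.midpoint η ∈ K n) :
    ∃ (κs : ℕ → Kernel Ω X) (κ : Kernel Ω X) (_ : ∀ n, IsMarkovKernel (κs n))
      (_ : IsMarkovKernel κ), (∀ n, κs n ∈ K n) ∧
      ∀ᵐ ω ∂P, Tendsto (fun n => (κs n).toProbabilityMeasure ω) atTop
        (𝓝 (κ.toProbabilityMeasure ω)) := by
  classical
  let F := TopologicalSpace.denseSeq C(X, ℝ)
  -- A finite measure with the null sets of counting measure: `L²` bounds hold, while almost
  -- everywhere for `Q` still means every index `j` for almost every `ω`.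
  let w : Measure ℕ := (Measure.count : Measure ℕ).toFinite
  let Q := P.prod w
  let C : ℕ → Set (Lp ℝ 2 Q) := fun n => {u | ∃ κ ∈ K n, u =ᵐ[Q] normalizedAverage F κ}
  obtain ⟨v, hvC, hv⟩ := exists_cauchySeq_mem_of_antitone_midpoint (C := C)
    (R := (measureUnivNNReal Q ^ (2 : ENNReal).toReal⁻¹ * 1 : ℝ) ^ 2)
    (fun n m hnm u ⟨κ, hκ, hu⟩ => ⟨κ, hanti hnm hκ, hu⟩)
    (fun n => by
      obtain ⟨κ, hκ⟩ := hne n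
      have := hmark n κ hκ
      have hL : MemLp (normalizedAverage F κ) 2 Q :=
        MemLp.of_bound (measurable_normalizedAverage F κ).aestronglyMeasurable 1
          (Eventually.of_forall (norm_normalizedAverage_le F κ))
      exact ⟨hL.toLp, κ, hκ, hL.coeFn_toLp⟩)
    (by
      rintro n u ⟨κ, hκ, hu⟩ v ⟨η, hη, hv⟩
      have := hmark n κ hκ
      have := hmark n η hη
      refine ⟨_, hmid n κ hκ η hη, ?_⟩
      filter_upwards [hu, hv, Lp.coeFn_smul (1 / 2 : ℝ) (u + v), Lp.coeFn_add u v]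
        with p h1 h2 h3 h4
      rw [h3, Pi.smul_apply, h4, Pi.add_apply, h1, h2, normalizedAverage_midpoint, smul_eq_mul])
    (by
      rintro u ⟨κ, hκ, hu⟩
      have := hmark 0 κ hκ
      refine pow_le_pow_left₀ (norm_nonneg _) (Lp.norm_le_of_ae_bound zero_le_one ?_) 2
      filter_upwards [hu] with p hp
      rw [hp]
      exact norm_normalizedAverage_le F κ p)
  obtain ⟨l, hl⟩ := cauchySeq_tendsto_of_complete hv
  obtain ⟨φ, hφ, hlim⟩ := (tendstoInMeasure_of_tendsto_Lp hl).exists_seq_tendsto_ae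
  choose κ hκ hvκ using hvC
  have hconv : ∀ᵐ ω ∂P, ∀ j, ∃ c, Tendsto (fun n => ∫ x, F j x ∂κ (φ n) ω) atTop (𝓝 c) := by
    have h1 : ∀ᵐ p ∂Q, ∃ c, Tendsto (fun n => ∫ x, F p.2 x ∂κ (φ n) p.1) atTop (𝓝 c) := by
      filter_upwards [hlim, ae_all_iff.2 hvκ] with p hp hvp
      refine ⟨(1 + ‖F p.2‖) * l p, (hp.const_mul (1 + ‖F p.2‖)).congr fun n => ?_⟩
      rw [hvp, normalizedAverage, mul_inv_cancel_left₀ (by positivity)]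
    filter_upwards [Measure.ae_ae_of_ae_prod h1] with ω hω j
    rw [ae_toFinite] at hω
    exact (Measure.ae_count_iff.1 hω) j
  have hmk : ∀ n, IsMarkovKernel (κ (φ n)) := fun n => hmark _ _ (hκ _)
  let G : Set Ω := {ω | ∀ j, ∃ c, Tendsto (fun n => ∫ x, F j x ∂κ (φ n) ω) atTop (𝓝 c)}
  have hG : MeasurableSet G := by
    have : G = ⋂ j, {ω | ∃ c, Tendsto (fun n => ∫ x, F j x ∂κ (φ n) ω) atTop (𝓝 c)} := by
      ext ω; simp [G]
    rw [this]
    exact MeasurableSet.iInter fun j => measurableSet_exists_tendsto fun n =>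
      ((F j).continuous.stronglyMeasurable.integral_kernel (κ := κ (φ n))).measurable
  -- Off the convergence set the sequence is frozen at its first term, so the limit exists
  -- everywhere and defines a kernel.
  let μ : ℕ → Ω → ProbabilityMeasure X := fun n ω =>
    if ω ∈ G then (κ (φ n)).toProbabilityMeasure ω else (κ (φ 0)).toProbabilityMeasure ω
  have hμval : ∀ n ω, (μ n ω : Measure X) = if ω ∈ G then κ (φ n) ω else κ (φ 0) ω := by
    intro n ω
    by_cases hω : ω ∈ G <;> simp [μ, hω, Kernel.toProbabilityMeasure]
  have hμm : ∀ n, Measurable fun ω => (μ n ω : Measure X) := fun n => by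
    simp only [hμval]
    exact Measurable.ite hG (κ (φ n)).measurable (κ (φ 0)).measurable
  have hμlim : ∀ ω, ∃ ν : ProbabilityMeasure X, Tendsto (fun n => μ n ω) atTop (𝓝 ν) := by
    intro ω
    by_cases hω : ω ∈ G
    · simp only [μ, if_pos hω]
      exact exists_tendsto_probabilityMeasure_of_dense
        (TopologicalSpace.denseRange_denseSeq C(X, ℝ)) _ hω
    · simp only [μ, if_neg hω]
      exact ⟨_, tendsto_const_nhds⟩
  choose ν hν using hμlim
  refine ⟨fun n => κ (φ n), ⟨fun ω => ν ω, measurable_toMeasure_of_tendsto hμm hν⟩, hmk,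
    ⟨fun ω => (ν ω).2⟩, fun n => hanti hφ.le_apply (hκ _), ?_⟩
  filter_upwards [hconv] with ω hω
  have := hν ω
  simp only [μ, if_pos (show ω ∈ G from hω)] at this
  exact this

end KernelLimit

/-! ### Orbit averages and almost invariant kernels. -/

section InvariantMeasure

variable {Ω X : Type*} [MeasurableSpace Ω] [MetricSpace X] [MeasurableSpace X] [BorelSpace X]

/-- For fixed `A`, restricting to the slab over `A` and projecting to `X` gives finite measures
determined by bounded continuous functions; this settles all rectangles. -/
theorem MeasureTheory.Measure.ext_of_lintegral_indicator_mul_boundedContinuous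
    {ρ₁ ρ₂ : Measure (Ω × X)} [IsFiniteMeasure ρ₁] [IsFiniteMeasure ρ₂]
    (h : ∀ A : Set Ω, MeasurableSet A → ∀ f : X →ᵇ ℝ≥0,
      ∫⁻ p, A.indicator 1 p.1 * (f p.2 : ℝ≥0∞) ∂ρ₁ = ∫⁻ p, A.indicator 1 p.1 * (f p.2 : ℝ≥0∞) ∂ρ₂) :
    ρ₁ = ρ₂ := by
  refine Measure.ext_prod fun {A B} hA hB => ?_
  have hfst : MeasurableSet (Prod.fst ⁻¹' A : Set (Ω × X)) := measurable_fst hA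
  have hval : ∀ (ρ : Measure (Ω × X)) (f : X →ᵇ ℝ≥0),
      ∫⁻ x, f x ∂((ρ.restrict (Prod.fst ⁻¹' A)).map Prod.snd)
        = ∫⁻ p, A.indicator 1 p.1 * (f p.2 : ℝ≥0∞) ∂ρ := by
    intro ρ f
    rw [lintegral_map (by fun_prop) measurable_snd, ← lintegral_indicator hfst]
    refine lintegral_congr fun p => ?_
    by_cases hp : p.1 ∈ A <;> simp [indicator, hp]
  have heq : (ρ₁.restrict (Prod.fst ⁻¹' A)).map Prod.snd
      = (ρ₂.restrict (Prod.fst ⁻¹' A)).map Prod.snd :=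
    ext_of_forall_lintegral_eq_of_IsFiniteMeasure fun f => by rw [hval, hval, h A hA f]
  have hrect : ∀ ρ : Measure (Ω × X),
      (ρ.restrict (Prod.fst ⁻¹' A)).map Prod.snd B = ρ (A ×ˢ B) := by
    intro ρ
    rw [Measure.map_apply measurable_snd hB, Measure.restrict_apply (measurable_snd hB),
      inter_comm]
    rfl
  rw [← hrect, ← hrect, heq]

/-- The average of the first `k` push-forwards under `Θ` of the graph measure of a section. -/
noncomputable def orbitAverage (P : Measure Ω) (Θ : Ω × X → Ω × X) (s : Ω → X) (k : ℕ) :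
    Measure (Ω × X) :=
  (k : ℝ≥0∞)⁻¹ • ∑ i ∈ Finset.range k, P.map fun ω => Θ^[i] (ω, s ω)

variable {P : Measure Ω} {Θ : Ω × X → Ω × X} {s : Ω → X}

omit [MetricSpace X] [BorelSpace X] in
theorem measurable_iterate_section (hΘ : Measurable Θ) (hs : Measurable s) (i : ℕ) :
    Measurable fun ω => Θ^[i] (ω, s ω) :=
  (hΘ.iterate i).comp (measurable_id.prodMk hs)

omit [MetricSpace X] [BorelSpace X] in
theorem lintegral_orbitAverage (hΘ : Measurable Θ) (hs : Measurable s) (k : ℕ)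
    {F : Ω × X → ℝ≥0∞} (hF : Measurable F) :
    ∫⁻ p, F p ∂orbitAverage P Θ s k
      = (k : ℝ≥0∞)⁻¹ * ∑ i ∈ Finset.range k, ∫⁻ ω, F (Θ^[i] (ω, s ω)) ∂P := by
  rw [orbitAverage, lintegral_smul_measure, lintegral_finsetSum_measure, smul_eq_mul]
  congr 1
  exact Finset.sum_congr rfl fun i _ => lintegral_map hF (measurable_iterate_section hΘ hs i)

omit [MetricSpace X] [BorelSpace X] in
theorem orbitAverage_apply (hΘ : Measurable Θ) (hs : Measurable s) (k : ℕ)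
    {B : Set (Ω × X)} (hB : MeasurableSet B) :
    orbitAverage P Θ s k B
      = (k : ℝ≥0∞)⁻¹ * ∑ i ∈ Finset.range k, P {ω | Θ^[i] (ω, s ω) ∈ B} := by
  rw [orbitAverage, Measure.smul_apply, Measure.finsetSum_apply, smul_eq_mul]
  congr 1
  exact Finset.sum_congr rfl fun i _ =>
    Measure.map_apply (measurable_iterate_section hΘ hs i) hB

omit [MetricSpace X] [BorelSpace X] in
theorem fst_orbitAverage {ϑ : Ω → Ω} (hϑ : MeasurePreserving ϑ P P) (hΘ : Measurable Θ)
    (hfst : ∀ p, (Θ p).1 = ϑ p.1) (hs : Measurable s) {k : ℕ} (hk : k ≠ 0) :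
    (orbitAverage P Θ s k).fst = P := by
  have hiter : ∀ (i : ℕ) (p : Ω × X), (Θ^[i] p).1 = ϑ^[i] p.1 := by
    intro i
    induction i with
    | zero => exact fun _ => rfl
    | succ i ih =>
      intro p
      rw [Function.iterate_succ_apply, Function.iterate_succ_apply, ih, hfst]
  ext A hA
  rw [Measure.fst_apply hA, orbitAverage_apply hΘ hs k (measurable_fst hA)]
  have : ∀ i ∈ Finset.range k, P {ω | Θ^[i] (ω, s ω) ∈ Prod.fst ⁻¹' A} = P A := by
    intro i _
    rw [← (hϑ.iterate i).measure_preimage hA.nullMeasurableSet]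
    congr 1
    ext ω
    simp [hiter]
  rw [Finset.sum_congr rfl this, Finset.sum_const, Finset.card_range, nsmul_eq_mul, ← mul_assoc,
    ENNReal.inv_mul_cancel (by exact_mod_cast hk) (ENNReal.natCast_ne_top k), one_mul]

theorem sum_range_add_le_of_le {a : ℕ → ℝ≥0∞} {c : ℝ≥0∞} (ha : ∀ i, a i ≤ c) (k : ℕ) :
    ∑ i ∈ Finset.range k, a (i + 1) ≤ ∑ i ∈ Finset.range k, a i + c ∧
      ∑ i ∈ Finset.range k, a i ≤ ∑ i ∈ Finset.range k, a (i + 1) + c := by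
  have h : ∑ i ∈ Finset.range k, a (i + 1) + a 0 = ∑ i ∈ Finset.range k, a i + a k := by
    rw [← Finset.sum_range_succ', Finset.sum_range_succ]
  constructor
  · exact (le_self_add.trans h.le).trans (by gcongr; exact ha k)
  · exact (le_self_add.trans h.ge).trans (by gcongr; exact ha 0)

/-- Markov kernels supported on the fibers of `S`, invariant under `Θ` up to `1 / (n + 1)` and
charging `E` with mass at least `ε`. -/
def almostInvariantKernels (P : Measure Ω) (Θ : Ω × X → Ω × X) (S : Set (Ω × X)) (E : Set X)
    (ε : ℝ≥0∞) (n : ℕ) : Set (Kernel Ω X) :=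
  {κ | IsMarkovKernel κ ∧ (∀ᵐ ω ∂P, κ ω (bundleFiber S ω)ᶜ = 0) ∧
    (∀ F : Ω × X → ℝ≥0∞, Measurable F → ∀ c : ℝ≥0, (∀ p, F p ≤ c) →
      ∫⁻ p, F (Θ p) ∂(P ⊗ₘ κ) ≤ ∫⁻ p, F p ∂(P ⊗ₘ κ) + c * ((n : ℝ≥0∞) + 1)⁻¹ ∧
      ∫⁻ p, F p ∂(P ⊗ₘ κ) ≤ ∫⁻ p, F (Θ p) ∂(P ⊗ₘ κ) + c * ((n : ℝ≥0∞) + 1)⁻¹) ∧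
    ε ≤ ∫⁻ ω, κ ω E ∂P}

omit [MetricSpace X] [BorelSpace X] in
theorem antitone_almostInvariantKernels (P : Measure Ω) (Θ : Ω × X → Ω × X) (S : Set (Ω × X))
    (E : Set X) (ε : ℝ≥0∞) : Antitone (almostInvariantKernels P Θ S E ε) := by
  rintro n m hnm κ ⟨h1, h2, h3, h4⟩
  have hle : ((m : ℝ≥0∞) + 1)⁻¹ ≤ ((n : ℝ≥0∞) + 1)⁻¹ := by gcongr
  refine ⟨h1, h2, fun F hF c hc => ?_, h4⟩
  obtain ⟨h5, h6⟩ := h3 F hF c hc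
  exact ⟨h5.trans (by gcongr), h6.trans (by gcongr)⟩

omit [MetricSpace X] [BorelSpace X] in
theorem lintegral_compProd_midpoint [SFinite P] (κ η : Kernel Ω X) [IsMarkovKernel κ]
    [IsMarkovKernel η] {F : Ω × X → ℝ≥0∞} (hF : Measurable F) :
    ∫⁻ p, F p ∂(P ⊗ₘ κ.midpoint η)
      = 2⁻¹ * (∫⁻ p, F p ∂(P ⊗ₘ κ) + ∫⁻ p, F p ∂(P ⊗ₘ η)) := by
  have hm : ∀ (κ : Kernel Ω X) [IsMarkovKernel κ], Measurable fun ω => ∫⁻ x, F (ω, x) ∂κ ω :=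
    fun κ _ => hF.lintegral_kernel_prod_right'
  rw [Measure.lintegral_compProd hF, Measure.lintegral_compProd hF, Measure.lintegral_compProd hF,
    ← lintegral_add_left (hm κ), ← lintegral_const_mul _ ((hm κ).fun_add (hm η))]
  refine lintegral_congr fun ω => ?_
  rw [Kernel.midpoint_apply, lintegral_smul_measure, lintegral_add_measure, ENNReal.smul_def,
    smul_eq_mul, ENNReal.coe_inv two_ne_zero, ENNReal.coe_ofNat]

theorem half_add_le {a b a' b' r : ℝ≥0∞} (ha : a ≤ a' + r) (hb : b ≤ b' + r) :
    2⁻¹ * (a + b) ≤ 2⁻¹ * (a' + b') + r := by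
  calc 2⁻¹ * (a + b) ≤ 2⁻¹ * ((a' + r) + (b' + r)) := by gcongr
    _ = 2⁻¹ * (a' + b') + 2⁻¹ * (r * 2) := by ring
    _ = 2⁻¹ * (a' + b') + r := by
      rw [mul_comm r, ← mul_assoc, ENNReal.inv_mul_cancel (by simp) (by simp), one_mul]

-- Every defining condition is affine in the kernel, including the two-sided defect bound.
omit [MetricSpace X] [BorelSpace X] in
theorem midpoint_mem_almostInvariantKernels [SFinite P] (hΘ : Measurable Θ) {S : Set (Ω × X)}
    {E : Set X} (hE : MeasurableSet E) {ε : ℝ≥0∞} {n : ℕ} {κ η : Kernel Ω X}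
    (hκ : κ ∈ almostInvariantKernels P Θ S E ε n) (hη : η ∈ almostInvariantKernels P Θ S E ε n) :
    κ.midpoint η ∈ almostInvariantKernels P Θ S E ε n := by
  obtain ⟨h1, h2, h3, h4⟩ := hκ
  obtain ⟨g1, g2, g3, g4⟩ := hη
  refine ⟨inferInstance, ?_, fun F hF c hc => ?_, ?_⟩
  · filter_upwards [h2, g2] with ω h g
    rw [Kernel.midpoint_apply, Measure.smul_apply, Measure.add_apply, h, g, add_zero, smul_zero]
  · have hFΘ : Measurable fun p => F (Θ p) := hF.comp hΘ
    rw [lintegral_compProd_midpoint κ η hF, lintegral_compProd_midpoint κ η hFΘ]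
    obtain ⟨h5, h6⟩ := h3 F hF c hc
    obtain ⟨g5, g6⟩ := g3 F hF c hc
    exact ⟨half_add_le h5 g5, half_add_le h6 g6⟩
  · have : ∀ ω, κ.midpoint η ω E = 2⁻¹ * (κ ω E + η ω E) := fun ω => by
      rw [Kernel.midpoint_apply, Measure.smul_apply, Measure.add_apply, ENNReal.smul_def,
        smul_eq_mul, ENNReal.coe_inv two_ne_zero, ENNReal.coe_ofNat]
    simp only [this]
    rw [lintegral_const_mul _ ((κ.measurable_coe hE).fun_add (η.measurable_coe hE)),
      lintegral_add_left (κ.measurable_coe hE)]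
    calc ε = 2⁻¹ * (ε * 2) := by
          rw [mul_comm ε, ← mul_assoc, ENNReal.inv_mul_cancel (by simp) (by simp), one_mul]
      _ = 2⁻¹ * (ε + ε) := by ring
      _ ≤ _ := by gcongr

/-- The kernel disintegrates the average of `n + 1` push-forwards of the graph of `s`. Applying `Θ`
shifts the sum and changes only its end terms, whence the defect `c / (n + 1)`. -/
theorem exists_mem_almostInvariantKernels [CompactSpace X] [Nonempty X] [IsProbabilityMeasure P]
    {ϑ : Ω → Ω}
    (hϑ : MeasurePreserving ϑ P P) (hΘ : Measurable Θ) (hfst : ∀ p, (Θ p).1 = ϑ p.1)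
    {S : Set (Ω × X)} (hS : MeasurableSet S) (hmaps : MapsTo Θ S S)
    {E : Set X} (hE : MeasurableSet E) {ε : ℝ≥0∞} (n : ℕ)
    (hs : Measurable s) (hsS : ∀ ω, (ω, s ω) ∈ S)
    (hε : ε * ((n : ℝ≥0∞) + 1)
      ≤ ∑ i ∈ Finset.range (n + 1), P {ω | (Θ^[i] (ω, s ω)).2 ∈ E}) :
    (almostInvariantKernels P Θ S E ε n).Nonempty := by
  set μ := orbitAverage P Θ s (n + 1) with hμ
  have hμP : μ.fst = P := fst_orbitAverage hϑ hΘ hfst hs n.succ_ne_zero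
  have hprob : IsProbabilityMeasure μ := by
    refine ⟨?_⟩
    rw [← Measure.fst_univ, hμP, measure_univ]
  have hdis : P ⊗ₘ μ.condKernel = μ := by
    conv_lhs => rw [← hμP]
    exact μ.disintegrate μ.condKernel
  have hk : ((n + 1 : ℕ) : ℝ≥0∞) = (n : ℝ≥0∞) + 1 := by push_cast; rfl
  refine ⟨μ.condKernel, inferInstance, ?_, fun F hF c hc => ?_, ?_⟩
  · have h0 : μ Sᶜ = 0 := by
      rw [hμ, orbitAverage_apply hΘ hs _ hS.compl]
      have : ∀ i, {ω | Θ^[i] (ω, s ω) ∈ Sᶜ} = ∅ := fun i =>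
        eq_empty_of_forall_notMem fun ω hω => hω (hmaps.iterate i (hsS ω))
      simp only [this, measure_empty, Finset.sum_const_zero, mul_zero]
    rw [← hdis, Measure.compProd_apply hS.compl, lintegral_eq_zero_iff
      (Kernel.measurable_kernel_prodMk_left hS.compl)] at h0
    exact h0
  · have hFΘ : Measurable fun p => F (Θ p) := hF.comp hΘ
    rw [hdis, hμ, lintegral_orbitAverage hΘ hs _ hF, lintegral_orbitAverage hΘ hs _ hFΘ, hk]
    have hsucc : ∀ i ω, F (Θ (Θ^[i] (ω, s ω))) = F (Θ^[i + 1] (ω, s ω)) := fun i ω => by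
      rw [Function.iterate_succ_apply']
    simp only [hsucc]
    obtain ⟨h1, h2⟩ := sum_range_add_le_of_le (a := fun i => ∫⁻ ω, F (Θ^[i] (ω, s ω)) ∂P)
      (c := c) (fun i => (lintegral_mono fun ω => hc _).trans (by simp)) (n + 1)
    rw [mul_comm (c : ℝ≥0∞), ← mul_add, ← mul_add]
    exact ⟨by gcongr, by gcongr⟩
  · have : ∫⁻ ω, μ.condKernel ω E ∂P = μ (univ ×ˢ E) := by
      conv_rhs => rw [← hdis]
      rw [Measure.compProd_apply (MeasurableSet.univ.prod hE)]
      simp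
    rw [this, hμ, orbitAverage_apply hΘ hs _ (MeasurableSet.univ.prod hE), hk]
    have hle := mul_le_mul_right hε ((n : ℝ≥0∞) + 1)⁻¹
    rw [mul_comm ε, ← mul_assoc, ENNReal.inv_mul_cancel (by simp) (by simp), one_mul] at hle
    simpa using hle

end InvariantMeasure

/-! ### Passage to an invariant limit. -/

section InvariantLimit

variable {Ω X : Type*} [MeasurableSpace Ω] [MetricSpace X] [CompactSpace X] [MeasurableSpace X]
  [BorelSpace X] {P : Measure Ω} [IsProbabilityMeasure P]

omit [CompactSpace X] in
theorem measure_compl_eq_zero_of_tendsto {μ : ℕ → ProbabilityMeasure X} {ν : ProbabilityMeasure X}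
    (h : Tendsto μ atTop (𝓝 ν)) {C : Set X} (hC : IsClosed C)
    (h0 : ∀ n, (μ n : Measure X) Cᶜ = 0) : (ν : Measure X) Cᶜ = 0 := by
  have hle := ProbabilityMeasure.limsup_measure_closed_le_of_tendsto h hC
  have h1 : ∀ n, (μ n : Measure X) C = 1 := fun n =>
    (prob_compl_eq_zero_iff hC.measurableSet).1 (h0 n)
  simp only [h1, limsup_const] at hle
  exact (prob_compl_eq_zero_iff hC.measurableSet).2 (le_antisymm prob_le_one hle)

/-- All measures, including the limit, live on `C`, so `f` may be replaced by a Tietze extension of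
its restriction to `C`. -/
theorem tendsto_lintegral_continuousOn {μ : ℕ → ProbabilityMeasure X} {ν : ProbabilityMeasure X}
    (h : Tendsto μ atTop (𝓝 ν)) {C : Set X} (hC : IsClosed C)
    (h0 : ∀ n, (μ n : Measure X) Cᶜ = 0) {f : X → ℝ≥0} (hf : ContinuousOn f C) :
    Tendsto (fun n => ∫⁻ x, f x ∂(μ n : Measure X)) atTop
      (𝓝 (∫⁻ x, f x ∂(ν : Measure X))) := by
  obtain ⟨g, hg⟩ := ContinuousMap.exists_restrict_eq hC
    (⟨C.domRestrict f, hf.domRestrict⟩ : C(C, ℝ≥0))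
  have hgf : ∀ x ∈ C, g x = f x := fun x hx => congrArg (fun F : C(C, ℝ≥0) => F ⟨x, hx⟩) hg
  have hcongr : ∀ μ : Measure X, μ Cᶜ = 0 → ∫⁻ x, f x ∂μ = ∫⁻ x, g x ∂μ := by
    intro μ hμ
    refine lintegral_congr_ae ?_
    filter_upwards [measure_eq_zero_iff_ae_notMem.1 hμ] with x hx
    rw [hgf x (not_not.1 hx)]
  rw [hcongr _ (measure_compl_eq_zero_of_tendsto h hC h0)]
  simp only [hcongr _ (h0 _)]
  exact ProbabilityMeasure.tendsto_iff_forall_lintegral_tendsto.1 h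
    (BoundedContinuousFunction.mkOfCompact g)

omit [MetricSpace X] [CompactSpace X] [BorelSpace X] in
theorem tendsto_lintegral_compProd {κs : ℕ → Kernel Ω X} {κ : Kernel Ω X}
    [∀ n, IsMarkovKernel (κs n)] [IsMarkovKernel κ] {F : Ω × X → ℝ≥0∞} (hF : Measurable F)
    {c : ℝ≥0} (hc : ∀ p, F p ≤ c)
    (h : ∀ᵐ ω ∂P, Tendsto (fun n => ∫⁻ x, F (ω, x) ∂κs n ω) atTop
      (𝓝 (∫⁻ x, F (ω, x) ∂κ ω))) :
    Tendsto (fun n => ∫⁻ p, F p ∂(P ⊗ₘ κs n)) atTop (𝓝 (∫⁻ p, F p ∂(P ⊗ₘ κ))) := by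
  simp only [Measure.lintegral_compProd hF]
  refine tendsto_lintegral_of_dominated_convergence (fun _ => (c : ℝ≥0∞))
    (fun n => hF.lintegral_kernel_prod_right') (fun n => Eventually.of_forall fun ω => ?_) (by simp) h
  exact (lintegral_mono fun x => hc (ω, x)).trans (by simp)

/-- Existence of an invariant measure charging `univ ×ˢ E`, from orbits of arbitrary length that
visit `E` with average frequency at least `ε`. -/
theorem exists_invariant_measure_of_frequent_visits {ϑ : Ω → Ω} (hϑ : MeasurePreserving ϑ P P)
    {t : Ω × X → X} (ht : Measurable t) {S : Set (Ω × X)} (hS : MeasurableSet S)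
    (hc : ∀ ω, IsCompact (bundleFiber S ω)) (hmaps : MapsTo (fun p => (ϑ p.1, t p)) S S)
    (hcont : ∀ᵐ ω ∂P, ContinuousOn (fun x => t (ω, x)) (bundleFiber S ω))
    {E : Set X} (hE : IsClosed E) {ε : ℝ≥0∞}
    (hvisits : ∀ n : ℕ, ∃ s : Ω → X, Measurable s ∧ (∀ ω, (ω, s ω) ∈ S) ∧
      ε * ((n : ℝ≥0∞) + 1) ≤ ∑ i ∈ Finset.range (n + 1),
        P {ω | ((fun p : Ω × X => (ϑ p.1, t p))^[i] (ω, s ω)).2 ∈ E}) :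
    ∃ μ : Measure (Ω × X), IsProbabilityMeasure μ ∧ μ.fst = P ∧ μ Sᶜ = 0 ∧
      MeasurePreserving (fun p : Ω × X => (ϑ p.1, t p)) μ μ ∧ ε ≤ μ (univ ×ˢ E) := by
  set Θ : Ω × X → Ω × X := fun p => (ϑ p.1, t p) with hΘdef
  have hΘ : Measurable Θ := (hϑ.measurable.comp measurable_fst).prodMk ht
  obtain ⟨ω₀⟩ : Nonempty Ω := nonempty_of_isProbabilityMeasure P
  have : Nonempty X := by
    obtain ⟨s, -⟩ := hvisits 0
    exact ⟨s ω₀⟩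
  obtain ⟨κs, κ, _, _, hmem, hlim⟩ := exists_tendsto_kernel_of_antitone_midpoint P
    (antitone_almostInvariantKernels P Θ S E ε)
    (fun n => by
      obtain ⟨s, hs, hsS, hε⟩ := hvisits n
      exact exists_mem_almostInvariantKernels hϑ hΘ (fun _ => rfl) hS hmaps hE.measurableSet n hs
        hsS hε)
    (fun n κ hκ => hκ.1)
    (fun n κ hκ η hη => midpoint_mem_almostInvariantKernels hΘ hE.measurableSet hκ hη)
  have hsupp : ∀ᵐ ω ∂P, ∀ n, κs n ω (bundleFiber S ω)ᶜ = 0 :=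
    ae_all_iff.2 fun n => (hmem n).2.1
  refine ⟨P ⊗ₘ κ, inferInstance, Measure.fst_compProd P κ, ?_, ⟨hΘ, ?_⟩, ?_⟩
  · rw [Measure.compProd_apply hS.compl, lintegral_eq_zero_iff
      (Kernel.measurable_kernel_prodMk_left hS.compl)]
    filter_upwards [hsupp, hlim] with ω h1 h2
    exact measure_compl_eq_zero_of_tendsto h2 (hc ω).isClosed h1
  · have : IsProbabilityMeasure ((P ⊗ₘ κ).map Θ) := Measure.isProbabilityMeasure_map hΘ.aemeasurable
    refine Measure.ext_of_lintegral_indicator_mul_boundedContinuous fun A hA f => ?_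
    set F : Ω × X → ℝ≥0∞ := fun p => A.indicator 1 p.1 * (f p.2 : ℝ≥0∞) with hFdef
    have hF : Measurable F :=
      ((measurable_one.indicator hA).comp measurable_fst).mul (by fun_prop)
    have hFΘ : Measurable fun p => F (Θ p) := hF.comp hΘ
    obtain ⟨c, hcf⟩ : ∃ c : ℝ≥0, ∀ p, F p ≤ c := by
      refine ⟨nndist f 0, fun p => ?_⟩
      have h1 : (f p.2 : ℝ≥0∞) ≤ nndist f 0 := by
        have := BoundedContinuousFunction.NNReal.upper_bound f p.2
        exact_mod_cast this
      refine le_trans ?_ h1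
      by_cases hp : p.1 ∈ A <;> simp [hFdef, hp]
    have hind : ∀ ω, A.indicator (1 : Ω → ℝ≥0∞) ω ≠ ⊤ := fun ω => by
      by_cases hp : ω ∈ A <;> simp [hp]
    rw [lintegral_map hF hΘ]
    have hlim1 : Tendsto (fun n => ∫⁻ p, F p ∂(P ⊗ₘ κs n)) atTop (𝓝 (∫⁻ p, F p ∂(P ⊗ₘ κ))) := by
      refine tendsto_lintegral_compProd hF hcf ?_
      filter_upwards [hlim] with ω h2
      simp only [hFdef, lintegral_const_mul' _ _ (hind _)]
      exact ENNReal.Tendsto.const_mul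
        (ProbabilityMeasure.tendsto_iff_forall_lintegral_tendsto.1 h2 f) (Or.inr (hind _))
    -- For fixed `ω` the indicator factor of `F ∘ Θ` is constant in `x`, and the other factor is
    -- continuous on the compact fiber carrying the kernels.
    have hlim2 : Tendsto (fun n => ∫⁻ p, F (Θ p) ∂(P ⊗ₘ κs n)) atTop
        (𝓝 (∫⁻ p, F (Θ p) ∂(P ⊗ₘ κ))) := by
      refine tendsto_lintegral_compProd hFΘ (fun p => hcf (Θ p)) ?_
      filter_upwards [hlim, hsupp, hcont] with ω h2 h1 h3
      simp only [hFdef, hΘdef, lintegral_const_mul' _ _ (hind _)]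
      exact ENNReal.Tendsto.const_mul (tendsto_lintegral_continuousOn h2 (hc ω).isClosed h1
        (f.continuous.comp_continuousOn h3)) (Or.inr (hind _))
    have herr : Tendsto (fun n : ℕ => (c : ℝ≥0∞) * ((n : ℝ≥0∞) + 1)⁻¹) atTop (𝓝 0) := by
      have h := (tendsto_add_atTop_iff_nat 1).2 ENNReal.tendsto_inv_nat_nhds_zero
      simpa using ENNReal.Tendsto.const_mul (a := (c : ℝ≥0∞)) h (Or.inr ENNReal.coe_ne_top)
    refine le_antisymm ?_ ?_
    · refine le_of_tendsto_of_tendsto' hlim2 (by simpa using hlim1.add herr) fun n => ?_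
      exact ((hmem n).2.2.1 F hF c hcf).1
    · refine le_of_tendsto_of_tendsto' hlim1 (by simpa using hlim2.add herr) fun n => ?_
      exact ((hmem n).2.2.1 F hF c hcf).2
  · have h1 : (P ⊗ₘ κ) (univ ×ˢ E) = ∫⁻ ω, κ ω E ∂P := by
      rw [Measure.compProd_apply (MeasurableSet.univ.prod hE.measurableSet)]
      simp
    rw [h1]
    -- Reverse Fatou moves the limsup inside the integral; the portmanteau inequality for closed `E`
    -- bounds it fiberwise.
    calc ε ≤ limsup (fun n => ∫⁻ ω, κs n ω E ∂P) atTop :=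
          le_limsup_of_frequently_le (Frequently.of_forall fun n => (hmem n).2.2.2)
      _ ≤ ∫⁻ ω, limsup (fun n => κs n ω E) atTop ∂P :=
          limsup_lintegral_le (fun _ => 1) (fun n => (κs n).measurable_coe hE.measurableSet)
            (fun n => Eventually.of_forall fun ω => prob_le_one) (by simp)
      _ ≤ ∫⁻ ω, κ ω E ∂P := by
          refine lintegral_mono_ae ?_
          filter_upwards [hlim] with ω h2
          exact ProbabilityMeasure.limsup_measure_closed_le_of_tendsto h2 hE

end InvariantLimit

/-! ### Visit counts of the bundle system. -/

namespace BundleRDS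

section Basic

variable {Ω : Type*} [MeasurableSpace Ω] {P : Measure Ω} {ϑ : Ω → Ω}
  {X : Type*} [MetricSpace X] [MeasurableSpace X] (T : BundleRDS P ϑ X)

open Classical in
/-- The fiber maps, extended by the identity off the bundle. -/
noncomputable def extendedMap (p : Ω × X) : X :=
  if h : p ∈ T.bundle then T.map p.1 ⟨p.2, h⟩ else p.2

/-- The skew product, extended to the whole product space. -/
noncomputable def extendedSkew (p : Ω × X) : Ω × X := (ϑ p.1, T.extendedMap p)

theorem extendedMap_coe (p : T.bundle) : T.extendedMap p = T.map p.1.1 ⟨p.1.2, p.2⟩ :=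
  dif_pos p.2

theorem extendedSkew_coe (p : T.bundle) : T.extendedSkew p = T.skewProduct p :=
  Prod.ext rfl (T.extendedMap_coe p)

theorem mapsTo_extendedSkew : MapsTo T.extendedSkew T.bundle T.bundle := fun p hp => by
  rw [T.extendedSkew_coe ⟨p, hp⟩]
  exact Subtype.property _

theorem extendedSkew_iterate_eq_skewProduct_iterate (n : ℕ) (p : T.bundle) :
    T.extendedSkew^[n] p = (T.skewProduct^[n] p : T.bundle) := by
  induction n generalizing p with
  | zero => rfl
  | succ n ih =>
    rw [Function.iterate_succ_apply, Function.iterate_succ_apply, extendedSkew_coe, ih]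

theorem extendedSkew_iterate_coe (n : ℕ) (p : T.bundle) :
    T.extendedSkew^[n] p = (ϑ^[n] p.1.1, (T.iter n p.1.1 ⟨p.1.2, p.2⟩ : X)) :=
  (T.extendedSkew_iterate_eq_skewProduct_iterate n p).trans (T.skewProduct_iterate n p)

theorem measurable_extendedMap : Measurable T.extendedMap := by
  classical
  refine measurable_of_restrict_of_restrict_compl T.measurableSet_bundle ?_ ?_
  · have : T.bundle.domRestrict T.extendedMap = fun p : T.bundle => (T.map p.1.1 ⟨p.1.2, p.2⟩ : X) :=
      funext T.extendedMap_coe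
    rw [this]
    exact T.measurable_map
  · have : T.bundleᶜ.domRestrict T.extendedMap = fun p => p.1.2 := funext fun p => dif_neg p.2
    rw [this]
    exact measurable_snd.comp measurable_subtype_coe

theorem measurable_extendedSkew (hϑ : Measurable ϑ) : Measurable T.extendedSkew :=
  (hϑ.comp measurable_fst).prodMk T.measurable_extendedMap

theorem measurable_skewProduct (hϑ : Measurable ϑ) : Measurable T.skewProduct :=
  Measurable.subtype_mk
    ((hϑ.comp (measurable_fst.comp measurable_subtype_coe)).prodMk T.measurable_map)

theorem continuousOn_extendedMap {ω : Ω} (h : Continuous (T.map ω)) :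
    ContinuousOn (fun x => T.extendedMap (ω, x)) (bundleFiber T.bundle ω) := by
  rw [continuousOn_iff_continuous_domRestrict]
  have : (bundleFiber T.bundle ω).domRestrict (fun x => T.extendedMap (ω, x))
      = fun x => (T.map ω x : X) := funext fun x => T.extendedMap_coe ⟨(ω, x), x.2⟩
  rw [this]
  exact continuous_subtype_val.comp h

theorem ae_continuous_iter (hϑ : MeasurePreserving ϑ P P) :
    ∀ᵐ ω ∂P, ∀ n, Continuous (T.iter n ω) := by
  have h : ∀ᵐ ω ∂P, ∀ i, Continuous (T.map (ϑ^[i] ω)) := ae_all_iff.2 fun i =>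
    (hϑ.iterate i).quasiMeasurePreserving.ae T.continuous_map
  filter_upwards [h] with ω hω n
  induction n generalizing ω with
  | zero => exact continuous_id
  | succ n ih => exact (ih (ϑ ω) fun i => hω (i + 1)).comp (hω 0)

/-- The number of visits to `E` of the first `n` points of the orbit of `p`. -/
noncomputable def visits (E : Set X) (n : ℕ) (p : Ω × X) : ℝ :=
  ∑ i ∈ Finset.range n, E.indicator (fun _ => (1 : ℝ)) (T.extendedSkew^[i] p).2

variable {E : Set X}

theorem visits_coe (n : ℕ) {ω : Ω} (x : bundleFiber T.bundle ω) :
    T.visits E n (ω, x) = ∑ i ∈ Finset.range n, E.indicator (fun _ => (1 : ℝ)) (T.iter i ω x : X) :=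
  Finset.sum_congr rfl fun i _ => by rw [T.extendedSkew_iterate_coe i ⟨(ω, x), x.2⟩]

theorem maxVisits_eq_ciSup_visits (n : ℕ) (ω : Ω) :
    T.maxVisits E n ω = ⨆ x : bundleFiber T.bundle ω, T.visits E n (ω, x) := by
  simp only [maxVisits, visits_coe]

theorem visits_nonneg (n : ℕ) (p : Ω × X) : 0 ≤ T.visits E n p :=
  Finset.sum_nonneg fun _ _ => indicator_nonneg (fun _ _ => zero_le_one) _

theorem visits_le (n : ℕ) (p : Ω × X) : T.visits E n p ≤ n := by
  refine (Finset.sum_le_sum fun i _ =>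
    indicator_le_self' (fun _ _ => zero_le_one) (T.extendedSkew^[i] p).2).trans ?_
  simp

theorem visits_add (m n : ℕ) (p : Ω × X) :
    T.visits E (m + n) p = T.visits E m p + T.visits E n (T.extendedSkew^[m] p) := by
  simp only [visits, Finset.sum_range_add, ← Function.iterate_add_apply, add_comm]

theorem measurable_visits (hϑ : Measurable ϑ) (hE : MeasurableSet E) (n : ℕ) :
    Measurable (T.visits E n) :=
  Finset.measurable_fun_sum _ fun i _ => (measurable_const.indicator hE).comp
    (measurable_snd.comp ((T.measurable_extendedSkew hϑ).iterate i))

theorem bddAbove_visits (n : ℕ) (ω : Ω) :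
    BddAbove (range fun x : bundleFiber T.bundle ω => T.visits E n (ω, x)) :=
  ⟨n, by rintro _ ⟨x, rfl⟩; exact T.visits_le n _⟩

theorem visits_le_maxVisits (n : ℕ) {ω : Ω} (x : bundleFiber T.bundle ω) :
    T.visits E n (ω, x) ≤ T.maxVisits E n ω := by
  rw [maxVisits_eq_ciSup_visits]
  exact le_ciSup (T.bddAbove_visits n ω) x

theorem maxVisits_nonneg (n : ℕ) (ω : Ω) : 0 ≤ T.maxVisits E n ω := by
  obtain ⟨x, hx⟩ := T.nonempty_fiber ω
  exact (T.visits_nonneg n _).trans (T.visits_le_maxVisits n ⟨x, hx⟩)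

theorem maxVisits_le (n : ℕ) (ω : Ω) : T.maxVisits E n ω ≤ n := by
  have := (T.nonempty_fiber ω).to_subtype
  rw [maxVisits_eq_ciSup_visits]
  exact ciSup_le fun x => T.visits_le n _

theorem maxVisits_add_le (m n : ℕ) (ω : Ω) :
    T.maxVisits E (m + n) ω ≤ T.maxVisits E m ω + T.maxVisits E n (ϑ^[m] ω) := by
  have := (T.nonempty_fiber ω).to_subtype
  rw [T.maxVisits_eq_ciSup_visits (m + n)]
  refine ciSup_le fun x => ?_
  rw [visits_add, T.extendedSkew_iterate_coe m ⟨(ω, x), x.2⟩]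
  exact add_le_add (T.visits_le_maxVisits m x) (T.visits_le_maxVisits n (T.iter m ω x))

/-- The indicator of a closed set is upper semicontinuous, and this survives composition with
continuous iterates and finite sums. -/
theorem upperSemicontinuous_visits (hE : IsClosed E) {ω : Ω} (h : ∀ n, Continuous (T.iter n ω))
    (n : ℕ) : UpperSemicontinuous fun x : bundleFiber T.bundle ω => T.visits E n (ω, x) := by
  simp only [visits_coe]
  exact upperSemicontinuous_sum fun i _ =>
    (hE.upperSemicontinuous_indicator zero_le_one).comp (continuous_subtype_val.comp (h i))

end Basic

/-! ### Smallness and invariant random measures. -/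

section Small

variable {Ω : Type*} [MeasurableSpace Ω] {P : Measure Ω} [IsProbabilityMeasure P] {ϑ : Ω → Ω}
  {X : Type*} [MetricSpace X] [MeasurableSpace X] (T : BundleRDS P ϑ X) {E : Set X}

omit [IsProbabilityMeasure P] in
theorem measure_eq_zero_of_isSmall (hϑ : Measurable ϑ) (hE : MeasurableSet E) (hsmall : T.IsSmall E)
    {μ : Measure (Ω × X)} (hμ : T.IsInvariantRandomMeasure μ) : μ (univ ×ˢ E) = 0 := by
  have := hμ.isProbabilityMeasure
  set ν := μ.comap (Subtype.val : T.bundle → Ω × X) with hν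
  have hνap : ∀ A : Set T.bundle, ν A = μ (Subtype.val '' A) := fun A =>
    comap_subtype_coe_apply T.measurableSet_bundle μ A
  have hcompl : μ T.bundleᶜ = 0 :=
    (prob_compl_eq_zero_iff T.measurableSet_bundle).2 hμ.bundle_eq_one
  have hνprob : IsProbabilityMeasure ν := by
    refine ⟨?_⟩
    rw [hνap, image_univ, Subtype.range_coe]
    exact hμ.bundle_eq_one
  have hfst : ∀ᵐ p ∂ν, T.HasOrbitCapacity E p.1.1 0 := by
    have h1 : ∀ᵐ p ∂μ, T.HasOrbitCapacity E p.1 0 := by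
      have h2 : ∀ᵐ ω ∂μ.map Prod.fst, T.HasOrbitCapacity E ω 0 := by
        rw [hμ.marginal]
        exact hsmall
      exact ae_of_ae_map measurable_fst.aemeasurable h2
    rw [ae_iff, hνap]
    refine measure_mono_null ?_ (ae_iff.1 h1)
    rintro _ ⟨p, hp, rfl⟩
    exact hp
  set g : T.bundle → ℝ := fun p => E.indicator (fun _ => (1 : ℝ)) p.1.2 with hg
  have hEm : MeasurableSet {p : T.bundle | p.1.2 ∈ E} :=
    (measurable_snd.comp measurable_subtype_coe) hE
  have hgm : Measurable g :=
    (measurable_const.indicator hE).comp (measurable_snd.comp measurable_subtype_coe)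
  have hgint : ∫ p, g p ∂ν = ν.real {p | p.1.2 ∈ E} := by
    rw [← integral_indicator_one hEm]
    rfl
  have hgi : Integrable g ν := Integrable.of_bound hgm.aestronglyMeasurable 1
    (Eventually.of_forall fun p => by
      rw [hg, Real.norm_of_nonneg (indicator_nonneg (fun _ _ => zero_le_one) _)]
      exact indicator_le_self' (fun _ _ => zero_le_one) _)
  have hmp : ∀ i, MeasurePreserving (T.skewProduct^[i]) ν ν := fun i => hμ.invariant.iterate i
  have hcomp : ∀ i, ∫ p, g (T.skewProduct^[i] p) ∂ν = ∫ p, g p ∂ν := fun i => by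
    conv_rhs => rw [← (hmp i).map_eq]
    exact (integral_map (hmp i).aemeasurable hgm.aestronglyMeasurable).symm
  have hvis : ∀ n (p : T.bundle),
      T.visits E n p = ∑ i ∈ Finset.range n, g (T.skewProduct^[i] p) := by
    intro n p
    refine Finset.sum_congr rfl fun i _ => ?_
    rw [extendedSkew_iterate_eq_skewProduct_iterate]
  -- By invariance each of the `n` visit terms has the same integral, so the mean frequency does not
  -- depend on `n`.
  have hint : ∀ n : ℕ, 0 < n → ∫ p : T.bundle, (1 / (n : ℝ)) * T.visits E n p ∂ν
      = ν.real {p | p.1.2 ∈ E} := by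
    intro n hn
    simp only [hvis]
    have hi : ∀ i, Integrable (fun p => g (T.skewProduct^[i] p)) ν := fun i =>
      (hmp i).integrable_comp_of_integrable hgi
    rw [integral_const_mul, integral_finsetSum _ fun i _ => hi i]
    simp only [hcomp, hgint, Finset.sum_const, Finset.card_range, nsmul_eq_mul]
    field_simp
  have hlim : Tendsto (fun n : ℕ => ∫ p : T.bundle, (1 / (n : ℝ)) * T.visits E n p ∂ν) atTop
      (𝓝 (∫ _, (0 : ℝ) ∂ν)) := by
    refine tendsto_integral_of_dominated_convergence (fun _ => 1) (fun n => ?_)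
      (integrable_const _) (fun n => Eventually.of_forall fun p => ?_) ?_
    · exact (((T.measurable_visits hϑ hE n).comp measurable_subtype_coe).const_mul
        _).aestronglyMeasurable
    · rw [Real.norm_of_nonneg (mul_nonneg (by positivity) (T.visits_nonneg n _)), one_div,
        inv_mul_eq_div]
      exact div_le_one_of_le₀ (T.visits_le n _) (by positivity)
    · filter_upwards [hfst] with p hp
      refine squeeze_zero (fun n => mul_nonneg (by positivity) (T.visits_nonneg n _))
        (fun n => ?_) hp
      exact mul_le_mul_of_nonneg_left (T.visits_le_maxVisits n ⟨p.1.2, p.2⟩) (by positivity)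
  have hzero : ν.real {p | p.1.2 ∈ E} = 0 := by
    refine tendsto_nhds_unique (tendsto_const_nhds.congr' ?_) (by simpa using hlim)
    filter_upwards [eventually_gt_atTop 0] with n hn
    simpa using (hint n hn).symm
  have hνz : ν {p | p.1.2 ∈ E} = 0 := (measureReal_eq_zero_iff).1 hzero
  rw [hνap] at hνz
  refine measure_mono_null (fun p hp => ?_) (measure_union_null hνz hcompl)
  by_cases h : p ∈ T.bundle
  · exact Or.inl ⟨⟨p, h⟩, hp.2, rfl⟩
  · exact Or.inr h

-- Inside the bundle the two skew products agree; the part of a preimage lying outside it is null.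
omit [IsProbabilityMeasure P] in
theorem isInvariantRandomMeasure_of_extendedSkew (hϑ : Measurable ϑ) {μ : Measure (Ω × X)}
    [IsProbabilityMeasure μ] (hfst : μ.fst = P) (h0 : μ T.bundleᶜ = 0)
    (hinv : MeasurePreserving T.extendedSkew μ μ) : T.IsInvariantRandomMeasure μ := by
  refine ⟨inferInstance, hfst, (prob_compl_eq_zero_iff T.measurableSet_bundle).1 h0,
    T.measurable_skewProduct hϑ, ?_⟩
  ext A hA
  rw [Measure.map_apply (T.measurable_skewProduct hϑ) hA,
    comap_subtype_coe_apply T.measurableSet_bundle, comap_subtype_coe_apply T.measurableSet_bundle,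
    ← hinv.measure_preimage (T.measurableSet_bundle.subtype_image hA).nullMeasurableSet,
    ← measure_inter_add_sdiff (T.extendedSkew ⁻¹' _) T.measurableSet_bundle,
    measure_mono_null (fun p hp => hp.2 : T.extendedSkew ⁻¹' (Subtype.val '' A) \ T.bundle ⊆ _) h0,
    add_zero]
  congr 1
  ext p
  constructor
  · rintro ⟨q, hq, rfl⟩
    exact ⟨⟨T.skewProduct q, hq, (T.extendedSkew_coe q).symm⟩, q.2⟩
  · rintro ⟨⟨q, hq, hqp⟩, hp⟩
    refine ⟨⟨p, hp⟩, ?_, rfl⟩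
    rw [T.extendedSkew_coe ⟨p, hp⟩] at hqp
    rwa [mem_preimage, ← Subtype.ext hqp]

variable [CompactSpace X] [BorelSpace X] [P.IsComplete]

theorem measurable_maxVisits (hϑ : Measurable ϑ) (hE : MeasurableSet E) (n : ℕ) :
    Measurable (T.maxVisits E n) := by
  have : T.maxVisits E n = fun ω => ⨆ x : bundleFiber T.bundle ω, T.visits E n (ω, x) :=
    funext fun ω => T.maxVisits_eq_ciSup_visits n ω
  rw [this]
  exact measurable_ciSup_fiber P T.measurableSet_bundle T.nonempty_fiber
    (T.measurable_visits hϑ hE n) (T.bddAbove_visits n)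

theorem exists_measurable_section_visits_eq (hϑ : MeasurePreserving ϑ P P) (hE : IsClosed E)
    (n : ℕ) :
    ∃ s : Ω → X, Measurable s ∧ (∀ ω, (ω, s ω) ∈ T.bundle) ∧
      ∀ᵐ ω ∂P, T.visits E n (ω, s ω) = T.maxVisits E n ω := by
  obtain ⟨ω₀⟩ : Nonempty Ω := nonempty_of_isProbabilityMeasure P
  have hX : Nonempty X := (T.nonempty_fiber ω₀).to_type
  set G : Set Ω := {ω | ∀ n, Continuous (T.iter n ω)} with hGdef
  have hG0 : P Gᶜ = 0 := T.ae_continuous_iter hϑ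
  have hG : MeasurableSet Gᶜ := Measure.IsComplete.out' _ hG0
  -- Over the null set where some iterate is discontinuous the whole fiber is kept, so every fiber
  -- of `D` is nonempty and compact; completeness makes that null set measurable.
  set D : Set (Ω × X) := T.bundle ∩
    (Prod.fst ⁻¹' Gᶜ ∪ {p | T.maxVisits E n p.1 ≤ T.visits E n p}) with hDdef
  have hD : MeasurableSet D := T.measurableSet_bundle.inter ((measurable_fst hG).union
    (measurableSet_le
      ((T.measurable_maxVisits hϑ.measurable hE.measurableSet n).comp measurable_fst)
      (T.measurable_visits hϑ.measurable hE.measurableSet n)))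
  have hfib : ∀ ω ∉ G, bundleFiber D ω = bundleFiber T.bundle ω := fun ω hω => by
    ext x
    exact ⟨fun h => h.1, fun h => ⟨h, Or.inl hω⟩⟩
  have hfib' : ∀ ω ∈ G, bundleFiber D ω = Subtype.val ''
      {x : bundleFiber T.bundle ω | T.maxVisits E n ω ≤ T.visits E n (ω, x)} := fun ω hω => by
    ext x
    constructor
    · rintro ⟨h1, h2 | h2⟩
      · exact absurd hω h2
      · exact ⟨⟨x, h1⟩, h2, rfl⟩
    · rintro ⟨y, hy, rfl⟩
      exact ⟨y.2, Or.inr hy⟩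
  obtain ⟨s, hs, hsD⟩ := exists_measurable_section P hD
    (fun ω => by
      by_cases hω : ω ∈ G
      · have := (T.nonempty_fiber ω).to_subtype
        have := isCompact_iff_compactSpace.1 (T.isCompact_fiber ω)
        obtain ⟨x, -, hx⟩ := (T.upperSemicontinuous_visits hE hω n).upperSemicontinuousOn
          univ |>.exists_isMaxOn univ_nonempty isCompact_univ
        rw [hfib' ω hω]
        refine Nonempty.image _ ⟨x, ?_⟩
        rw [mem_ofPred_eq, maxVisits_eq_ciSup_visits]
        exact ciSup_le fun y => hx (mem_univ y)
      · rw [hfib ω hω]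
        exact T.nonempty_fiber ω)
    (fun ω => by
      by_cases hω : ω ∈ G
      · have := isCompact_iff_compactSpace.1 (T.isCompact_fiber ω)
        rw [hfib' ω hω]
        exact ((T.upperSemicontinuous_visits hE hω n).isClosed_preimage _).isCompact.image
          continuous_subtype_val
      · rw [hfib ω hω]
        exact T.isCompact_fiber ω)
  refine ⟨s, hs, fun ω => (hsD ω).1, ?_⟩
  filter_upwards [T.ae_continuous_iter hϑ] with ω hω
  exact le_antisymm (T.visits_le_maxVisits n ⟨s ω, (hsD ω).1⟩)
    ((hsD ω).2.resolve_left fun h => h hω)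

theorem exists_isInvariantRandomMeasure (hϑ : MeasurePreserving ϑ P P) (hE : IsClosed E) {ε : ℝ}
    (hε : ∀ k : ℕ, 0 < k → ε * k ≤ ∫ ω, T.maxVisits E k ω ∂P) :
    ∃ μ : Measure (Ω × X), T.IsInvariantRandomMeasure μ ∧ ENNReal.ofReal ε ≤ μ (univ ×ˢ E) := by
  obtain ⟨μ, hμ, hfst, h0, hinv, hle⟩ := exists_invariant_measure_of_frequent_visits
    (ε := ENNReal.ofReal ε) hϑ T.measurable_extendedMap T.measurableSet_bundle T.isCompact_fiber
    T.mapsTo_extendedSkew (T.continuous_map.mono fun ω h => T.continuousOn_extendedMap h) hE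
    fun n => by
      obtain ⟨s, hs, hsT, hmax⟩ := T.exists_measurable_section_visits_eq hϑ hE (n + 1)
      refine ⟨s, hs, hsT, ?_⟩
      change ENNReal.ofReal ε * ((n : ℝ≥0∞) + 1)
        ≤ ∑ i ∈ Finset.range (n + 1), P {ω | (T.extendedSkew^[i] (ω, s ω)).2 ∈ E}
      have hm : ∀ i, MeasurableSet {ω | (T.extendedSkew^[i] (ω, s ω)).2 ∈ E} := fun i =>
        (measurable_snd.comp (measurable_iterate_section
          (T.measurable_extendedSkew hϑ.measurable) hs i)) hE.measurableSet
      have hsum : ∫ ω, T.maxVisits E (n + 1) ω ∂P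
          = ∑ i ∈ Finset.range (n + 1), P.real {ω | (T.extendedSkew^[i] (ω, s ω)).2 ∈ E} := by
        rw [← integral_congr_ae hmax]
        simp only [visits]
        have hind : ∀ i ω, E.indicator (fun _ => (1 : ℝ)) (T.extendedSkew^[i] (ω, s ω)).2
            = {ω | (T.extendedSkew^[i] (ω, s ω)).2 ∈ E}.indicator 1 ω := fun _ _ => rfl
        simp only [hind]
        rw [integral_finsetSum _ fun i _ => (integrable_const 1).indicator (hm i)]
        exact Finset.sum_congr rfl fun i _ => integral_indicator_one (hm i)
      have h1 := hε (n + 1) n.succ_pos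
      rw [hsum] at h1
      have h2 := ENNReal.ofReal_le_ofReal h1
      rw [ENNReal.ofReal_mul' (by positivity), ENNReal.ofReal_natCast,
        ENNReal.ofReal_sum_of_nonneg fun _ _ => measureReal_nonneg] at h2
      simpa using h2
  exact ⟨μ, T.isInvariantRandomMeasure_of_extendedSkew hϑ.measurable hfst h0 hinv, hle⟩

end Small

end BundleRDS

theorem mainTheorem6 {Ω : Type*} [MeasurableSpace Ω] (P : Measure Ω) [IsProbabilityMeasure P]
    [P.IsComplete] (ϑ : Ω → Ω) (hϑ : MeasurePreserving ϑ P P)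
    {X : Type*} [MetricSpace X] [CompactSpace X] [MeasurableSpace X] [BorelSpace X]
    (T : BundleRDS P ϑ X) (E : Set X) (hE : IsClosed E) :
    T.IsSmall E ↔
      ∀ μ : Measure (Ω × X), T.IsInvariantRandomMeasure μ → μ (Set.univ ×ˢ E) = 0 := by
  refine ⟨fun h μ hμ => T.measure_eq_zero_of_isSmall hϑ.measurable hE.measurableSet h hμ,
    fun h => ?_⟩
  refine ae_tendsto_zero_of_subadditive hϑ
    (fun n => T.measurable_maxVisits hϑ.measurable hE.measurableSet n) T.maxVisits_nonneg
    T.maxVisits_le T.maxVisits_add_le fun ε hε => ?_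
  -- The negation bounds `∫ b_k` below by `ε * k` for all `k > 0`, which yields an invariant measure
  -- charging `univ ×ˢ E`.
  by_contra! hcon
  obtain ⟨μ, hμ, hle⟩ := T.exists_isInvariantRandomMeasure hϑ hE hcon
  rw [h μ hμ] at hle
  exact (ENNReal.ofReal_pos.2 hε).not_ge hle
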